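/- Let $F$ be a field, $K$ a finite simplicial complex (geometrically realised in a real normed space), $|K|$ its underlying space, and $X$ a topological space. Let $Z\subseteq\mathbb R$ be an interval, bounded or unbounded (for instance $Z=\mathbb R$ or a compact interval). Towers of covers. A tower of covers $\mathfrak W$ of $Z$ with resolution $r=\mathrm{res}(\mathfrak W)$ consists of, for each real $\varepsilon\ge r$, a locally finite indexed cover $\mathcal W_\varepsilon$ of $Z$ by path connected (relatively) open sets, together with, for $r\le\varepsilon\le\varepsilon'$, maps of index sets $w_{\varepsilon,\varepsilon'}$ from $\mathcal W_\varepsilon$ to $\mathcal W_{\varepsilon'}$ sending each member to a member that contains it, with $w_{\varepsilon,\varepsilon}=\mathrm{id}$ and $w_{\varepsilon',\varepsilon''}\circ w_{\varepsilon,\varepsilon'}=w_{\varepsilon,\varepsilon''}$. (If $Z$ is compact, each $\mathcal W_\varepsilon$ is finite.) For $c\ge 1$ and $s>0$, the tower is $(c,s)$-good if $\mathrm{res}(\mathfrak W)=s\le\mathrm{diam}(Z)$; $\mathrm{diam}(W)\le\varepsilon$ for all $\varepsilon\ge s$ and all $W\in\mathcal W_\varepsilon$; and every bounded $O\subseteq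 Z$ with $\mathrm{diam}(O)\ge s$ is contained in some $W\in\mathcal W_{c\cdot\mathrm{diam}(O)}$. The tower $\mathrm R_{\log}(\mathfrak W)$ has resolution $\log s$ and cover $\mathcal W_{e^{\varepsilon}}$ at scale $\varepsilon\ge\log s$. Multiscale mapper. For a continuous map $u:Y\to Z$, the pullback of a tower of covers has at each scale the cover of $Y$ by all path components of the preimages of the members of the cover, a component being sent to the component that contains it; $\mathrm{MM}(\mathfrak W,u)$ is the tower of nerves of these covers. $\mathrm D_k\mathrm{MM}(\mathfrak W,u)$ denotes the persistence diagram of the persistence module obtained by applying $k$-th simplicial homology with coefficients in $F$ (the module being $0$ below its resolution). Diagrams are multisets of points (birth, death) with birth $<$ death $\le\infty$. The bottleneck distance between two diagrams is the infimum, over all partial matchings of the points with finite death together with bijections of the points with infinite death, of the larger of: the supremum of the $\ell^\infty$-distances of matched points (of the births, for points with infinite death), and the supremum of the $\ell^\infty$-distances to the diagonal of unmatched points; it is $\infty$ if there is no such bijection. Statement. Let $f:|K|\to\mathbb R$ be piecewise linear, i.e. given by its values at the vertices of $K$ and interpolated linearly on each simplex. Let $g:X\to\mathbb R$ be continuous.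 Suppose that $f$ and $g$ take values in $Z$ and that $g$, as a map into $Z$, is well-behaved: $g^{-1}(U)$ has finitely many path components for every path connected open $U\subseteq Z$. Suppose that $f$ $\delta$-approximates $g$: there is a homeomorphism $h:X\to|K|$ with $|f(y)-g(h^{-1}(y))|\le\delta$ for all $y\in|K|$. Let $\mathfrak W$ be a $(c,s)$-good tower of covers of $Z$. Then for every $k\in\mathbb N$ the persistence modules $\mathrm H_k(\mathrm{MM}(\mathrm R_{\log}(\mathfrak W),f);F)$ and $\mathrm H_k(\mathrm{MM}(\mathrm R_{\log}(\mathfrak W),g);F)$ are pointwise finite dimensional, and the bottleneck distance between the persistence diagrams $\mathrm D_k\mathrm{MM}(\mathrm R_{\log}(\mathfrak W),f)$ and $\mathrm D_k\mathrm{MM}(\mathrm R_{\log}(\mathfrak W),g)$ is at most $$\log\big(2c\max(s,\delta)+c\big)+\max\Big(0,\log\frac1s\Big).$$ -/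

import Mathlib

open CategoryTheory
open scoped ENNReal

universe u v

noncomputable section

namespace MultiMapper

/-! ### Towers of covers -/

/-- A tower of covers of `X` with resolution `res`: for every `ε ≥ res` an indexed family of sets
covering `X`, together with functorial maps of covers from scale `a` to every scale `b ≥ a`. -/
structure CoverTower (X : Type v) where
  res : ℝ
  ι : Set.Ici res → Type u
  U : ∀ a, ι a → Set X
  iUnion_eq : ∀ a, ⋃ i, U a i = Set.univ
  map : ∀ {a b : Set.Ici res}, a ≤ b → ι a → ι b
  subset_map : ∀ {a b : Set.Ici res} (h : a ≤ b) (i : ι a), U a i ⊆ U b (map h i)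
  map_refl : ∀ (a : Set.Ici res) (i : ι a), map (le_refl a) i = i
  map_trans : ∀ {a b c : Set.Ici res} (h : a ≤ b) (h' : b ≤ c) (i : ι a),
    map h' (map h i) = map (h.trans h') i

/-- The covers are locally finite and consist of path connected open sets. On a compact space,
local finiteness means that every cover has finitely many members. -/
structure CoverTower.IsOpenTower {Z : Type v} [TopologicalSpace Z] (W : CoverTower.{u} Z) : Prop where
  isOpen : ∀ a i, IsOpen (W.U a i)
  isPathConnected : ∀ a i, IsPathConnected (W.U a i)
  locallyFinite : ∀ a, LocallyFinite (W.U a)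

/-- `(c, s)`-good towers of covers of a metric space. Bounded sets are singled out in the last
field because the space is not assumed to be bounded; there `a` is the scale `c * diam O`, which is
`≥ s` since `c ≥ 1`. -/
structure CoverTower.IsGood {Z : Type v} [MetricSpace Z] (W : CoverTower.{u} Z) (c s : ℝ) : Prop where
  one_le : 1 ≤ c
  pos : 0 < s
  res_eq : W.res = s
  le_diam : ENNReal.ofReal s ≤ Metric.ediam (Set.univ : Set Z)
  diam_le : ∀ (a : Set.Ici W.res) (i : W.ι a), Metric.ediam (W.U a i) ≤ ENNReal.ofReal (a : ℝ)
  exists_superset : ∀ O : Set Z, Bornology.IsBounded O → s ≤ Metric.diam O →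
    ∀ a : Set.Ici W.res, (a : ℝ) = c * Metric.diam O → ∃ i : W.ι a, O ⊆ W.U a i

theorem CoverTower.IsGood.res_pos {Z : Type v} [MetricSpace Z] {W : CoverTower.{u} Z} {c s : ℝ}
    (h : W.IsGood c s) : 0 < W.res := h.res_eq ▸ h.pos

/-- Reindexing along a monotone map of parameters `ψ`. -/
def CoverTower.reindex {X : Type v} (W : CoverTower.{u} X) {r : ℝ}
    (ψ : Set.Ici r →o Set.Ici W.res) : CoverTower.{u} X where
  res := r
  ι a := W.ι (ψ a)
  U a := W.U (ψ a)
  iUnion_eq a := W.iUnion_eq (ψ a)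
  map h := W.map (ψ.monotone h)
  subset_map h := W.subset_map (ψ.monotone h)
  map_refl a := W.map_refl (ψ a)
  map_trans h h' := W.map_trans (ψ.monotone h) (ψ.monotone h')

/-- The exponential `[log r, ∞) → [r, ∞)`, inverse to the logarithm. -/
def expIci {r : ℝ} (hr : 0 < r) : Set.Ici (Real.log r) →o Set.Ici r where
  toFun a := ⟨Real.exp a, (Real.log_le_iff_le_exp hr).1 a.2⟩
  monotone' _ _ h := Subtype.mk_le_mk.2 (Real.exp_le_exp.2 h)

/-- The tower `R_log W`: its resolution is `log (res W)` and its cover at scale `ε` is the cover of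
`W` at scale `exp ε`. -/
def CoverTower.reindexLog {X : Type v} (W : CoverTower.{u} X) (h : 0 < W.res) :
    CoverTower.{u} X :=
  W.reindex (expIci h)

/-! ### Pullbacks -/

/-- The map on path components induced by an inclusion of sets. -/
def componentMap {X : Type u} [TopologicalSpace X] {A B : Set X} (h : A ⊆ B) :
    ZerothHomotopy A → ZerothHomotopy B :=
  Quotient.map (Set.inclusion h) fun _ _ ⟨p⟩ => ⟨p.map (continuous_inclusion h)⟩

/-- A path component of `A`, as a subset of the ambient space. -/
def componentSet {X : Type u} [TopologicalSpace X] {A : Set X} (c : ZerothHomotopy A) : Set X :=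
  {x | ∃ h : x ∈ A, (Quotient.mk _ ⟨x, h⟩ : ZerothHomotopy A) = c}

/-- The pullback tower: the cover at each scale consists of all path components of the preimages
of the members of the given cover, and each component is mapped to the component containing it. -/
def CoverTower.pullback {X : Type u} {Z : Type v} [TopologicalSpace X] (W : CoverTower.{u} Z)
    (f : X → Z) : CoverTower.{u} X where
  res := W.res
  ι a := Σ i : W.ι a, ZerothHomotopy (f ⁻¹' W.U a i)
  U a i := componentSet i.2
  iUnion_eq a := by
    refine Set.eq_univ_of_forall fun x => ?_
    have hx : f x ∈ ⋃ i, W.U a i := by rw [W.iUnion_eq a]; trivial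
    obtain ⟨i, hi⟩ := Set.mem_iUnion.1 hx
    exact Set.mem_iUnion.2 ⟨⟨i, Quotient.mk _ ⟨x, hi⟩⟩, hi, rfl⟩
  map h i := ⟨W.map h i.1, componentMap (Set.preimage_mono (W.subset_map h i.1)) i.2⟩
  subset_map := by
    rintro a b h ⟨i, c⟩ x ⟨hx, hc⟩
    refine ⟨W.subset_map h i hx, ?_⟩
    dsimp only at hc ⊢
    rw [← hc]
    rfl
  map_refl := by
    rintro a ⟨i, c⟩
    induction c using Quotient.inductionOn with
    | h x =>
      have key : ∀ (j : W.ι a) (hj : j = i) (hx : x.1 ∈ f ⁻¹' W.U a j),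
          (⟨j, Quotient.mk _ ⟨x.1, hx⟩⟩ : Σ i : W.ι a, ZerothHomotopy (f ⁻¹' W.U a i)) =
            ⟨i, Quotient.mk _ x⟩ := by
        rintro j rfl hx
        rfl
      exact key _ (W.map_refl a i) _
  map_trans := by
    rintro a b c h h' ⟨i, q⟩
    induction q using Quotient.inductionOn with
    | h x =>
      have key : ∀ (j j' : W.ι c) (hj : j = j') (hx : x.1 ∈ f ⁻¹' W.U c j)
          (hx' : x.1 ∈ f ⁻¹' W.U c j'),
          (⟨j, Quotient.mk _ ⟨x.1, hx⟩⟩ : Σ i : W.ι c, ZerothHomotopy (f ⁻¹' W.U c i)) =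
            ⟨j', Quotient.mk _ ⟨x.1, hx'⟩⟩ := by
        rintro j _ rfl hx hx'
        rfl
      exact key _ _ (W.map_trans h h' i) _ _

/-- A map is well-behaved if preimages of path connected open sets have only finitely many path
components. -/
def WellBehaved {X : Type u} {Z : Type v} [TopologicalSpace X] [TopologicalSpace Z] (f : X → Z) : Prop :=
  ∀ V : Set Z, IsOpen V → IsPathConnected V → Finite (ZerothHomotopy (f ⁻¹' V))

/-! ### Nerves and the multiscale mapper -/

/-- A tower of simplicial complexes and simplicial maps. -/
structure SimplicialTower where
  res : ℝ
  V : Set.Ici res → Type u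
  K : ∀ a, PreAbstractSimplicialComplex (V a)
  map : ∀ {a b : Set.Ici res}, a ≤ b → V a → V b
  map_mem : ∀ {a b : Set.Ici res} (h : a ≤ b) (σ : Finset (V a)) (τ : Finset (V b)),
    σ ∈ (K a).faces → (τ : Set (V b)) = map h '' σ → τ ∈ (K b).faces
  map_refl : ∀ (a : Set.Ici res) (v : V a), map (le_refl a) v = v
  map_trans : ∀ {a b c : Set.Ici res} (h : a ≤ b) (h' : b ≤ c) (v : V a),
    map h' (map h v) = map (h.trans h') v

/-- The nerve of a family of sets: a nonempty finite set of indices is a simplex if and only if the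
corresponding sets have a common point. -/
def nerve {X : Type v} {ι : Type u} (U : ι → Set X) : PreAbstractSimplicialComplex ι where
  faces := {σ | σ.Nonempty ∧ (⋂ i ∈ σ, U i).Nonempty}
  isRelLowerSet_faces := fun _ hσ => ⟨hσ.1, fun _ hτ hne =>
    ⟨hne, hσ.2.mono (Set.biInter_mono hτ fun _ _ => subset_rfl)⟩⟩

/-- The nerve of a tower of covers. -/
def CoverTower.nerve {X : Type v} (W : CoverTower.{u} X) : SimplicialTower.{u} where
  res := W.res
  V := W.ι
  K a := MultiMapper.nerve (W.U a)
  map h := W.map h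
  map_mem := by
    rintro a b h σ τ ⟨⟨i, hi⟩, x, hx⟩ hτ
    simp only [Set.mem_iInter] at hx
    have hmem : ∀ j, j ∈ τ ↔ ∃ i ∈ σ, W.map h i = j := fun j => by
      rw [← Finset.mem_coe, hτ]; simp
    refine ⟨⟨_, (hmem _).2 ⟨i, hi, rfl⟩⟩, x, ?_⟩
    simp only [Set.mem_iInter]
    intro j hj
    obtain ⟨i, hi, rfl⟩ := (hmem j).1 hj
    exact W.subset_map h i (hx i hi)
  map_refl := W.map_refl
  map_trans := W.map_trans

/-- The multiscale mapper `MM(W, f)`. -/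
def MM {X : Type u} {Z : Type v} [TopologicalSpace X] (W : CoverTower.{u} Z) (f : X → Z) :
    SimplicialTower.{u} :=
  (W.pullback f).nerve

/-! ### Simplicial homology -/

/-- The simplicial set of ordered simplices of a simplicial complex: its `n`-simplices are the
tuples `(v₀, …, vₙ)` (repetitions allowed) whose entries span a simplex. Its chain complex is the
ordered chain complex of the simplicial complex, which computes simplicial homology. -/
def orderedSSet {V : Type u} (K : PreAbstractSimplicialComplex V) : SSet.{u} where
  obj n := {t : Fin (n.unop.len + 1) → V // ∃ σ ∈ K.faces, (σ : Set V) = Set.range t}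
  map φ := ↾fun t => ⟨t.1 ∘ φ.unop.toOrderHom, by
    classical
    obtain ⟨σ, hσ, hr⟩ := t.2
    refine ⟨Finset.univ.image (t.1 ∘ φ.unop.toOrderHom),
      (K.isRelLowerSet_faces hσ).2 ?_ ⟨_, Finset.mem_image_of_mem _ (Finset.mem_univ 0)⟩,
      by rw [Finset.coe_image, Finset.coe_univ, Set.image_univ]⟩
    intro v hv
    obtain ⟨i, -, rfl⟩ := Finset.mem_image.1 hv
    rw [← Finset.mem_coe, hr]
    exact ⟨_, rfl⟩⟩

/-- A tower of simplicial complexes as a functor to simplicial sets. -/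
def SimplicialTower.toSSet (S : SimplicialTower.{u}) : Set.Ici S.res ⥤ SSet.{u} where
  obj a := orderedSSet (S.K a)
  map {a b} h :=
    { app := fun _ => ↾fun t => ⟨S.map (leOfHom h) ∘ t.1, by
        classical
        obtain ⟨σ, hσ, hr⟩ := t.2
        refine ⟨σ.image (S.map (leOfHom h)), S.map_mem (leOfHom h) σ _ hσ (by simp), ?_⟩
        rw [Finset.coe_image, hr, Set.range_comp]⟩
      naturality := fun _ _ _ => rfl }
  map_id a := by
    ext n t
    exact Subtype.ext (funext fun i => S.map_refl a _)
  map_comp h h' := by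
    ext n t
    exact Subtype.ext (funext fun i => (S.map_trans (leOfHom h) (leOfHom h') _).symm)

/-- The persistence module `H_k(S; F)` of a tower of simplicial complexes. -/
def SimplicialTower.homology (F : Type u) [Field F] (k : ℕ) (S : SimplicialTower.{u}) :
    Set.Ici S.res ⥤ ModuleCat.{u} F :=
  S.toSSet ⋙ (SSet.chainComplexFunctor (ModuleCat.{u} F)).obj (ModuleCat.of F F) ⋙
    HomologicalComplex.homologyFunctor (ModuleCat.{u} F) (ComplexShape.down ℕ) k

/-- The persistence module `H_k(MM(R_log W, f); F)`. -/
def mapperHomology (F : Type u) [Field F] (k : ℕ) {X : Type u} {Z : Type v} [TopologicalSpace X]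
    (W : CoverTower.{u} Z) (hW : 0 < W.res) (f : X → Z) :
    Set.Ici (Real.log W.res) ⥤ ModuleCat.{u} F :=
  (MM (W.reindexLog hW) f).homology F k

/-! ### Persistence diagrams and the bottleneck distance -/

section Persistence

variable {F : Type u} [Field F] {r : ℝ}

/-- All the vector spaces of the persistence module have finite dimension. -/
def PointwiseFinite (M : Set.Ici r ⥤ ModuleCat.{u} F) : Prop :=
  ∀ a, Module.Finite F (M.obj a)

open Classical in
/-- The rank of the structure map from `a` to `b`, the module being extended by zero to the left of
its resolution. -/
def persistentRank (M : Set.Ici r ⥤ ModuleCat.{u} F) (a b : ℝ) : ℕ :=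
  if h : r ≤ a ∧ a ≤ b then
    Module.finrank F (LinearMap.range
      (M.map (homOfLE (show (⟨a, h.1⟩ : Set.Ici r) ≤ ⟨b, h.1.trans h.2⟩ from h.2))).hom)
  else 0

/-- Number of classes born between `a` and `b` (present at `b` but not at `a`) that die between
`c` and `d`, for `a < b ≤ c < d`. -/
def boxCount (M : Set.Ici r ⥤ ModuleCat.{u} F) (a b c d : ℝ) : ℕ :=
  (persistentRank M b c + persistentRank M a d) - (persistentRank M a c + persistentRank M b d)

/-- Number of classes born between `a` and `b` that are still alive at `c`, for `a < b ≤ c`. -/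
def stripCount (M : Set.Ici r ⥤ ModuleCat.{u} F) (a b c : ℝ) : ℕ :=
  persistentRank M b c - persistentRank M a c

/-- A persistence diagram: a multiset of points (birth, death) with finite death, and a multiset of
births of the points whose death is infinite, both given by their multiplicity functions. -/
structure Diagram where
  finite : ℝ × ℝ → ℕ
  essential : ℝ → ℕ

open Classical in
/-- The persistence diagram of a pointwise finite dimensional persistence module. The multiplicity
of an off-diagonal point is the number of classes in all sufficiently small boxes around it. -/
def diagram (M : Set.Ici r ⥤ ModuleCat.{u} F) : Diagram where
  finite p :=
    if p.1 < p.2 then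
      sInf {m | ∃ ε : ℝ, 0 < ε ∧ p.1 + ε ≤ p.2 - ε ∧
        m = boxCount M (p.1 - ε) (p.1 + ε) (p.2 - ε) (p.2 + ε)}
    else 0
  essential b :=
    sInf {m | ∃ ε t : ℝ, 0 < ε ∧ b + ε ≤ t ∧ m = stripCount M (b - ε) (b + ε) t}

/-- The points of a multiset, repeated according to multiplicity. -/
abbrev Points {α : Type} (m : α → ℕ) : Type := Σ x : α, Fin (m x)

/-- Distance of a point to the diagonal in the `ℓ^∞` metric. -/
def diagDist (p : ℝ × ℝ) : ℝ≥0∞ := ENNReal.ofReal ((p.2 - p.1) / 2)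

/-- The cost of a partial matching of the points with finite death: matched points pay their
`ℓ^∞` distance, unmatched points are matched with the diagonal. -/
def matchingCost {m n : ℝ × ℝ → ℕ} (μ : Points m ≃. Points n) : ℝ≥0∞ :=
  max (⨆ (x) (y) (_ : y ∈ μ x), edist x.1 y.1)
    (max (⨆ (x) (_ : μ x = none), diagDist x.1) (⨆ (y) (_ : μ.symm y = none), diagDist y.1))

/-- The bottleneck distance. Points with infinite death can only be matched with each other. -/
def bottleneckDist (D D' : Diagram) : ℝ≥0∞ :=
  ⨅ (μ : Points D.finite ≃. Points D'.finite) (e : Points D.essential ≃ Points D'.essential),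
    max (matchingCost μ) (⨆ x, edist x.1 (e x).1)

end Persistence

/-! ### Piecewise-linear functions -/

section PL

variable {E : Type u} [NormedAddCommGroup E] [NormedSpace ℝ E]

/-- `f : |K| → ℝ` is piecewise linear on `K`: it is given by values `φ` at the vertices and
interpolates them linearly in each simplex. -/
def IsPL (K : Geometry.SimplicialComplex ℝ E) (f : K.space → ℝ) : Prop :=
  ∃ φ : E → ℝ, ∀ σ ∈ K.faces, ∀ w : E → ℝ, (∀ v ∈ σ, 0 ≤ w v) → ∑ v ∈ σ, w v = 1 →
    ∀ y : K.space, (y : E) = ∑ v ∈ σ, w v • v → f y = ∑ v ∈ σ, w v * φ v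

/-- `f : |K| → ℝ` `δ`-approximates `g : X → ℝ` if `|f - g ∘ h⁻¹| ≤ δ` on `|K|` for some
homeomorphism `h : X → |K|`. -/
def DeltaApproximates {X : Type u} [TopologicalSpace X] (K : Geometry.SimplicialComplex ℝ E)
    (f : K.space → ℝ) (g : X → ℝ) (δ : ℝ) : Prop :=
  ∃ h : X ≃ₜ K.space, ∀ y : K.space, |f y - g (h.symm y)| ≤ δ

end PL

end MultiMapper

end

noncomputable section

namespace MultiMapper

/-! ### Maps between nerves -/

section NerveMap

variable {X Y Y' : Type u} {ι κ lam : Type u}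

/-! Two maps of covers over the same map of spaces are contiguous, so they agree on the homology of
nerves (`nerveHomologyMap_congr`). Arbitrary choices of covering members therefore already satisfy
all the identities of an interleaving, and it suffices to show that a member at scale `a`, pulled
back by one function, lies in a member at scale `b ≥ a + η` pulled back by the other, up to the
homeomorphism.

Put `D = max s δ`. The `D`-neighbourhood of a member of diameter at most `ε` has diameter between
`s` and `ε + 2D`, so goodness encloses it at scale `c(ε + 2D)`. Since `ε ≥ s`, the number `ε ·
max(1, 1/s)` is at least `1` and at least `ε`, whence `c(ε + 2D) ≤ ε · max(1, 1/s) · (2cD + c)`. The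
logarithm of the constant factor is the asserted bound.

Algebraic stability is proved from rank functions alone, without interval decompositions. The image
of an `η`-interleaving map `M → N` is a quotient of `M` and a submodule of the shift of `N`; kernel
and cokernel are annihilated by a shift of `2η`. Quotients preserve births and submodules preserve
deaths. Among the points with a common birth (or death), each is labelled by a level of a monotone
counting function, and points of equal level are matched: inequalities between counting functions
become inequalities between coordinates. Points with infinite death are treated in the same way with
the counting function `essFn`.

Finite dimensionality holds because a compact range meets finitely many members of a locally finite
cover, and each preimage has finitely many components. For piecewise linear `f`, the preimage of an
interval is convex in each simplex. -/

theorem range_simplex_nerve_iff {n : ℕ} (U : ι → Set X) (t : Fin (n + 1) → ι) :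
    (∃ σ ∈ (nerve U).faces, (σ : Set ι) = Set.range t) ↔ ∃ x, ∀ j, x ∈ U (t j) := by
  classical
  constructor
  · rintro ⟨σ, ⟨-, x, hx⟩, hr⟩
    refine ⟨x, fun j => ?_⟩
    simp only [Set.mem_iInter] at hx
    exact hx _ (by rw [← Finset.mem_coe, hr]; exact ⟨j, rfl⟩)
  · rintro ⟨x, hx⟩
    refine ⟨Finset.univ.image t, ⟨⟨t 0, by simp⟩, x, ?_⟩, by simp⟩
    simp only [Set.mem_iInter]
    intro i hi
    obtain ⟨j, -, rfl⟩ := Finset.mem_image.1 hi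
    exact hx j

/-- The map of nerves induced by a map of covers over `h`. -/
def nerveMap (h : X → Y) {U : ι → Set X} {U' : κ → Set Y} (φ : ι → κ)
    (hφ : ∀ i, ∀ x ∈ U i, h x ∈ U' (φ i)) :
    orderedSSet (MultiMapper.nerve U) ⟶ orderedSSet (MultiMapper.nerve U') where
  app _ := ↾fun t => ⟨φ ∘ t.1, by
    obtain ⟨x, hx⟩ := (range_simplex_nerve_iff U t.1).1 t.2
    exact (range_simplex_nerve_iff U' _).2 ⟨h x, fun j => hφ _ _ (hx j)⟩⟩
  naturality _ _ _ := rfl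

theorem nerveMap_comp (h : X → Y) (h' : Y → Y') {U : ι → Set X} {U' : κ → Set Y}
    {U'' : lam → Set Y'} (φ : ι → κ) (hφ : ∀ i, ∀ x ∈ U i, h x ∈ U' (φ i)) (ψ : κ → lam)
    (hψ : ∀ i, ∀ x ∈ U' i, h' x ∈ U'' (ψ i)) :
    nerveMap h φ hφ ≫ nerveMap h' ψ hψ =
      nerveMap (h' ∘ h) (U := U) (U' := U'') (ψ ∘ φ) (fun i x hx => hψ _ _ (hφ i x hx)) :=
  rfl

open MonoidalCategory Simplicial

/-- Two maps of covers over the same map are contiguous, so the maps of nerves are homotopic. -/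
def nerveMapHomotopy (h : X → Y) {U : ι → Set X} {U' : κ → Set Y} (φ ψ : ι → κ)
    (hφ : ∀ i, ∀ x ∈ U i, h x ∈ U' (φ i)) (hψ : ∀ i, ∀ x ∈ U i, h x ∈ U' (ψ i)) :
    SSet.Homotopy (nerveMap h φ hφ) (nerveMap h ψ hψ) where
  h :=
    -- Entries over the vertex `0` of the interval move by `φ`, the others by `ψ`. The mixed tuple
    -- is still a simplex: all its members contain the image of one common point.
    { app := fun n => ↾fun p => ⟨fun i =>
          if (SSet.stdSimplex.objEquiv p.2).toOrderHom i = 0 then φ (p.1.1 i) else ψ (p.1.1 i), by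
        obtain ⟨x, hx⟩ := (range_simplex_nerve_iff U p.1.1).1 p.1.2
        refine (range_simplex_nerve_iff U' _).2 ⟨h x, fun j => ?_⟩
        split_ifs
        · exact hφ _ _ (hx j)
        · exact hψ _ _ (hx j)⟩
      naturality := fun _ _ _ => rfl }
  h₀ := rfl
  h₁ := rfl
  rel := by ext _ ⟨⟨_, ⟨⟩⟩, _⟩

end NerveMap

/-! ### Homology of nerves -/

section Homology

variable (F : Type u) [Field F] (k : ℕ) {X Y Y' : Type u} {ι κ lam : Type u}

/-- The homology of the nerve of a family of sets. -/
abbrev nerveHomology (U : ι → Set X) : ModuleCat.{u} F :=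
  SSet.homology (orderedSSet (MultiMapper.nerve U)) (ModuleCat.of F F) k

/-- The map on the homology of nerves induced by a map of covers over `h`. -/
def nerveHomologyMap (h : X → Y) {U : ι → Set X} {U' : κ → Set Y} (φ : ι → κ)
    (hφ : ∀ i, ∀ x ∈ U i, h x ∈ U' (φ i)) : nerveHomology F k U ⟶ nerveHomology F k U' :=
  SSet.homologyMap (nerveMap h φ hφ) (ModuleCat.of F F) k

/-- Contiguity removes every dependence on the choice of indices. Two names for the underlying map
are allowed so that composites such as `h ∘ h.symm` can be compared with `id`. -/
theorem nerveHomologyMap_congr {h h' : X → Y} (hh : h = h') {U : ι → Set X} {U' : κ → Set Y}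
    (φ ψ : ι → κ) (hφ : ∀ i, ∀ x ∈ U i, h x ∈ U' (φ i)) (hψ : ∀ i, ∀ x ∈ U i, h' x ∈ U' (ψ i)) :
    nerveHomologyMap F k h φ hφ = nerveHomologyMap F k h' ψ hψ := by
  subst hh
  exact (nerveMapHomotopy h φ ψ hφ hψ).congr_homologyMap _ _

theorem nerveHomologyMap_comp (h : X → Y) (h' : Y → Y') {U : ι → Set X} {U' : κ → Set Y}
    {U'' : lam → Set Y'} (φ : ι → κ) (hφ : ∀ i, ∀ x ∈ U i, h x ∈ U' (φ i)) (ψ : κ → lam)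
    (hψ : ∀ i, ∀ x ∈ U' i, h' x ∈ U'' (ψ i)) :
    nerveHomologyMap F k h φ hφ ≫ nerveHomologyMap F k h' ψ hψ =
      nerveHomologyMap F k (h' ∘ h) (U := U) (U' := U'') (ψ ∘ φ)
        (fun i x hx => hψ _ _ (hφ i x hx)) := by
  rw [nerveHomologyMap, nerveHomologyMap, ← SSet.homologyMap_comp, nerveMap_comp]
  rfl

/-- The nerve of a finite family has finite-dimensional homology. -/
theorem finite_nerveHomology [Finite ι] (U : ι → Set X) :
    Module.Finite F (nerveHomology F k U) := by
  classical
  -- The chain group is a coproduct of copies of `F` over the tuples of length `k + 1`, a finite set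
  -- even with repetitions; homology is a quotient of a subspace of it.
  have hX : Module.Finite F (((orderedSSet (MultiMapper.nerve U)).chainComplex
      (ModuleCat.of F F)).X k) := by
    let S := orderedSSet (MultiMapper.nerve U)
    let J := S.obj (Opposite.op (SimplexCategory.mk k))
    have : Finite J := inferInstanceAs (Finite {t : Fin (k + 1) → ι //
      ∃ σ ∈ (MultiMapper.nerve U).faces, (σ : Set ι) = Set.range t})
    have e := (S.isColimitChainComplexXCofan (ModuleCat.of F F) k).coconePointUniqueUpToIso
      (ModuleCat.coproductCoconeIsColimit (R := F) fun _ : J => ModuleCat.of F F)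
    have : Fintype J := Fintype.ofFinite J
    have : Module.Finite F (ModuleCat.coproductCocone fun _ : J => ModuleCat.of F F).pt :=
      inferInstanceAs (Module.Finite F (DirectSum J fun _ => F))
    exact Module.Finite.equiv e.toLinearEquiv.symm
  let C := (orderedSSet (MultiMapper.nerve U)).chainComplex (ModuleCat.of F F)
  let j : C.cycles k ⟶ C.X k := C.iCycles k
  let q : C.cycles k ⟶ C.homology k := C.homologyπ k
  have hj : Mono j := inferInstanceAs (Mono (C.iCycles k))
  have hq : Epi q := inferInstanceAs (Epi (C.homologyπ k))
  have hZ : Module.Finite F (C.cycles k) :=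
    Module.Finite.of_injective j.hom ((ModuleCat.mono_iff_injective j).1 hj)
  exact Module.Finite.of_surjective q.hom ((ModuleCat.epi_iff_surjective q).1 hq)

end Homology

/-- The structure maps of the persistence module of the multiscale mapper are induced by the maps
of covers of the pullback tower. -/
theorem mapperHomology_map (F : Type u) [Field F] (k : ℕ) {X : Type u} {Z : Type v}
    [TopologicalSpace X] (W : CoverTower.{u} Z) (hW : 0 < W.res) (f : X → Z)
    {a b : Set.Ici (Real.log W.res)} (h : a ⟶ b) :
    (mapperHomology F k W hW f).map h =
      nerveHomologyMap F k id (((W.reindexLog hW).pullback f).map (leOfHom h))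
        (fun i => ((W.reindexLog hW).pullback f).subset_map (leOfHom h) i) :=
  rfl

/-! ### Rank functions and their diagrams -/

/-- The formal properties of the function `(a, b) ↦ rank (M_a → M_b)` for a persistence module
which vanishes below `r`. -/
structure IsRankFunction (r : ℝ) (ρ : ℝ → ℝ → ℕ) : Prop where
  mono : ∀ {a a' b}, a ≤ a' → a' ≤ b → ρ a b ≤ ρ a' b
  anti : ∀ {a b b'}, a ≤ b → b ≤ b' → ρ a b' ≤ ρ a b
  box : ∀ {a a' b b'}, a ≤ a' → a' ≤ b → b ≤ b' → ρ a' b' + ρ a b ≤ ρ a b' + ρ a' b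
  zero : ∀ {a b}, a < r → ρ a b = 0

open Classical in
/-- The multiplicity of a point with finite death in the diagram of a rank function. -/
def rankMult (ρ : ℝ → ℝ → ℕ) (p : ℝ × ℝ) : ℕ :=
  if p.1 < p.2 then
    sInf {m | ∃ ε : ℝ, 0 < ε ∧ p.1 + ε ≤ p.2 - ε ∧
      m = (ρ (p.1 + ε) (p.2 - ε) + ρ (p.1 - ε) (p.2 + ε)) -
        (ρ (p.1 - ε) (p.2 - ε) + ρ (p.1 + ε) (p.2 + ε))}
  else 0

/-- The multiplicity of a birth with infinite death in the diagram of a rank function. -/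
def rankEss (ρ : ℝ → ℝ → ℕ) (b : ℝ) : ℕ :=
  sInf {m | ∃ ε t : ℝ, 0 < ε ∧ b + ε ≤ t ∧ m = ρ (b + ε) t - ρ (b - ε) t}

/-- The number of classes born at `b` and alive at `y`. -/
def birthFn (ρ : ℝ → ℝ → ℕ) (b y : ℝ) : ℕ :=
  sInf {m | ∃ x₀ x₁ : ℝ, x₀ < b ∧ b < x₁ ∧ x₁ ≤ y ∧ m = ρ x₁ y - ρ x₀ y}

/-- The number of classes alive at `x` and dying at `d`. -/
def deathFn (ρ : ℝ → ℝ → ℕ) (d x : ℝ) : ℕ :=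
  sInf {m | ∃ y₀ y₁ : ℝ, y₀ < d ∧ d < y₁ ∧ x ≤ y₀ ∧ m = ρ x y₀ - ρ x y₁}

/-- The number of classes alive at `x` that never die. -/
def essFn (ρ : ℝ → ℝ → ℕ) (x : ℝ) : ℕ :=
  sInf {m | ∃ y : ℝ, x ≤ y ∧ m = ρ x y}

/-- The infimum over `(b, t]` is attained, being one of natural numbers, and monotonicity forces
this value everywhere closer to `b`. -/
theorem exists_const_right {φ : ℝ → ℕ} {b t : ℝ} (hbt : b < t)
    (hφ : ∀ x x', b < x → x ≤ x' → x' ≤ t → φ x ≤ φ x') :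
    ∃ ε > 0, b + ε ≤ t ∧ ∀ x x', b < x → x < b + ε → b < x' → x' < b + ε → φ x = φ x' := by
  have hne : {m | ∃ x, b < x ∧ x ≤ t ∧ m = φ x}.Nonempty := ⟨_, t, hbt, le_rfl, rfl⟩
  obtain ⟨x₀, h1, h2, h3⟩ := Nat.sInf_mem hne
  have key : ∀ x, b < x → x < x₀ → φ x = φ x₀ := fun x hx hx' =>
    le_antisymm (hφ _ _ hx hx'.le h2) (h3 ▸ Nat.sInf_le ⟨x, hx, by linarith, rfl⟩)
  exact ⟨x₀ - b, by linarith, by linarith, fun x x' a1 a2 a3 a4 =>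
    (key x a1 (by linarith)).trans (key x' a3 (by linarith)).symm⟩

theorem exists_const_left {φ : ℝ → ℕ} {b t : ℝ} (hbt : t < b)
    (hφ : ∀ x x', x ≤ x' → x' ≤ b → φ x ≤ φ x') :
    ∃ ε > 0, t ≤ b - ε ∧ ∀ x x', b - ε < x → x < b → b - ε < x' → x' < b → φ x = φ x' := by
  have hne : {m | ∃ x, t ≤ x ∧ x < b ∧ m = φ b - φ x}.Nonempty := ⟨_, t, le_rfl, hbt, rfl⟩
  obtain ⟨x₀, h1, h2, h3⟩ := Nat.sInf_mem hne
  have key : ∀ x, x₀ < x → x < b → φ x = φ x₀ := fun x hx hx' => by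
    have h4 : φ b - φ x₀ ≤ φ b - φ x := h3 ▸ Nat.sInf_le ⟨x, by linarith, hx', rfl⟩
    have := hφ x₀ x hx.le hx'.le
    have := hφ x b hx'.le le_rfl
    omega
  exact ⟨b - x₀, by linarith, by linarith, fun x x' a1 a2 a3 a4 =>
    (key x (by linarith) a2).trans (key x' (by linarith) a4).symm⟩

/-! ### Local constancy of ranks, and multiplicities as jumps -/

section RankFunction

variable {r : ℝ} {ρ : ℝ → ℝ → ℕ} (hρ : IsRankFunction r ρ)
include hρ

/-- By the box inequality, an increment in the first variable can only shrink as the second grows.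
Constancy at the single height `t` thus spreads to all `y ≥ t` with the same `ε`. -/
theorem IsRankFunction.exists_const_birth {b t : ℝ} (hbt : b < t) :
    ∃ ε > 0, b + ε ≤ t ∧ ∀ y, t ≤ y →
      (∀ x x', b < x → x < b + ε → b < x' → x' < b + ε → ρ x y = ρ x' y) ∧
      (∀ x x', b - ε < x → x < b → b - ε < x' → x' < b → ρ x y = ρ x' y) := by
  obtain ⟨ε₁, h1, h2, h3⟩ := exists_const_right (φ := fun x => ρ x t) hbt
    fun x x' _ h h' => hρ.mono h h'
  obtain ⟨ε₂, h4, h5, h6⟩ := exists_const_left (φ := fun x => ρ x t) (sub_one_lt b)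
    fun x x' h h' => hρ.mono h (by linarith)
  have main : ∀ {x x' y}, x ≤ x' → x' ≤ t → t ≤ y → ρ x t = ρ x' t → ρ x y = ρ x' y := by
    intro x x' y a1 a2 a3 a4
    have := hρ.box a1 a2 a3
    have := hρ.mono a1 (a2.trans a3)
    omega
  refine ⟨min ε₁ ε₂, lt_min h1 h4, by linarith [min_le_left ε₁ ε₂], fun y hy => ⟨?_, ?_⟩⟩
  · intro x x' a1 a2 a3 a4
    have := min_le_left ε₁ ε₂
    have e := h3 x x' a1 (by linarith) a3 (by linarith)
    rcases le_total x x' with h | h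
    · exact main h (by linarith) hy e
    · exact (main h (by linarith) hy e.symm).symm
  · intro x x' a1 a2 a3 a4
    have := min_le_right ε₁ ε₂
    have e := h6 x x' (by linarith) a2 (by linarith) a4
    rcases le_total x x' with h | h
    · exact main h (by linarith) hy e
    · exact (main h (by linarith) hy e.symm).symm

theorem IsRankFunction.exists_const_death {d t : ℝ} (htd : t < d) :
    ∃ ε > 0, t ≤ d - ε ∧ ∀ x, x ≤ t →
      (∀ y y', d < y → y < d + ε → d < y' → y' < d + ε → ρ x y = ρ x y') ∧
      (∀ y y', d - ε < y → y < d → d - ε < y' → y' < d → ρ x y = ρ x y') := by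
  obtain ⟨ε₁, h1, -, h3⟩ := exists_const_right (φ := fun y => ρ t t - ρ t y) (lt_add_one d)
    fun y y' h h' _ => Nat.sub_le_sub_left (hρ.anti (by linarith) h') _
  -- Subtraction from `ρ t t` makes the function increasing; `max t y` extends it below `t`, where
  -- `ρ t` is not known to be monotone.
  obtain ⟨ε₂, h4, h5, h6⟩ := exists_const_left (φ := fun y => ρ t t - ρ t (max t y)) htd
    fun y y' h _ => Nat.sub_le_sub_left (hρ.anti (le_max_left _ _) (max_le_max le_rfl h)) _
  have main : ∀ {x y y'}, x ≤ t → t ≤ y → y ≤ y' → ρ t t - ρ t y = ρ t t - ρ t y' →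
      ρ x y = ρ x y' := by
    intro x y y' a1 a2 a3 a4
    have := hρ.box a1 a2 a3
    have := hρ.anti (a1.trans a2) a3
    have := hρ.anti le_rfl a2
    have := hρ.anti le_rfl (a2.trans a3)
    omega
  refine ⟨min ε₁ ε₂, lt_min h1 h4, by linarith [min_le_right ε₁ ε₂], fun x hx => ⟨?_, ?_⟩⟩
  · intro y y' a1 a2 a3 a4
    have := min_le_left ε₁ ε₂
    have e := h3 y y' a1 (by linarith) a3 (by linarith)
    rcases le_total y y' with h | h
    · exact main hx (by linarith) h e
    · exact (main hx (by linarith) h e.symm).symm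
  · intro y y' a1 a2 a3 a4
    have := min_le_right ε₁ ε₂
    have e := h6 y y' (by linarith) a2 (by linarith) a4
    simp only [max_eq_right (show t ≤ y by linarith), max_eq_right (show t ≤ y' by linarith)] at e
    rcases le_total y y' with h | h
    · exact main hx (by linarith) h e
    · exact (main hx (by linarith) h e.symm).symm

theorem IsRankFunction.exists_birthFn_eq {b t : ℝ} (hbt : b < t) :
    ∃ ε > 0, b + ε ≤ t ∧ ∀ y, t ≤ y → ∀ x₀ x₁, b - ε < x₀ → x₀ < b → b < x₁ → x₁ < b + ε →
      birthFn ρ b y + ρ x₀ y = ρ x₁ y := by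
  obtain ⟨ε, h1, h2, h3⟩ := hρ.exists_const_birth hbt
  refine ⟨ε, h1, h2, fun y hy x₀ x₁ a1 a2 a3 a4 => ?_⟩
  obtain ⟨c1, c2⟩ := h3 y hy
  have hm := hρ.mono (show x₀ ≤ x₁ by linarith) (show x₁ ≤ y by linarith)
  have : birthFn ρ b y = ρ x₁ y - ρ x₀ y := by
    refine le_antisymm (Nat.sInf_le ⟨x₀, x₁, a2, a3, by linarith, rfl⟩) ?_
    refine le_csInf ⟨_, x₀, x₁, a2, a3, by linarith, rfl⟩ ?_
    rintro m ⟨z₀, z₁, e1, e2, e3, rfl⟩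
    have f1 := hρ.mono (min_le_left z₁ x₁) e3
    have f2 := hρ.mono (le_max_left z₀ x₀) (show max z₀ x₀ ≤ y from max_le (by linarith) (by linarith))
    have f3 := c1 (min z₁ x₁) x₁ (lt_min e2 a3) (by linarith [min_le_right z₁ x₁]) a3 a4
    have f4 := c2 (max z₀ x₀) x₀ (by linarith [le_max_right z₀ x₀]) (max_lt e1 a2) a1 a2
    omega
  omega

theorem IsRankFunction.exists_deathFn_eq {d t : ℝ} (htd : t < d) :
    ∃ ε > 0, t ≤ d - ε ∧ ∀ x, x ≤ t → ∀ y₀ y₁, d - ε < y₀ → y₀ < d → d < y₁ → y₁ < d + ε →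
      deathFn ρ d x + ρ x y₁ = ρ x y₀ := by
  obtain ⟨ε, h1, h2, h3⟩ := hρ.exists_const_death htd
  refine ⟨ε, h1, h2, fun x hx y₀ y₁ a1 a2 a3 a4 => ?_⟩
  obtain ⟨c1, c2⟩ := h3 x hx
  have hm := hρ.anti (show x ≤ y₀ by linarith) (show y₀ ≤ y₁ by linarith)
  have : deathFn ρ d x = ρ x y₀ - ρ x y₁ := by
    refine le_antisymm (Nat.sInf_le ⟨y₀, y₁, a2, a3, by linarith, rfl⟩) ?_
    refine le_csInf ⟨_, y₀, y₁, a2, a3, by linarith, rfl⟩ ?_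
    rintro m ⟨z₀, z₁, e1, e2, e3, rfl⟩
    have f1 := hρ.anti (show x ≤ min z₁ y₁ from le_min (by linarith) (by linarith)) (min_le_left z₁ y₁)
    have f2 := hρ.anti e3 (le_max_left z₀ y₀)
    have f3 := c1 (min z₁ y₁) y₁ (lt_min e2 a3) (by linarith [min_le_right z₁ y₁]) a3 a4
    have f4 := c2 (max z₀ y₀) y₀ (by linarith [le_max_right z₀ y₀]) (max_lt e1 a2) a1 a2
    omega
  omega

theorem IsRankFunction.birthFn_anti {b y y' : ℝ} (hb : b < y) (hy : y ≤ y') :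
    birthFn ρ b y' ≤ birthFn ρ b y := by
  obtain ⟨ε, h1, h2, h3⟩ := hρ.exists_birthFn_eq hb
  have e1 := h3 y le_rfl (b - ε / 2) (b + ε / 2) (by linarith) (by linarith) (by linarith)
    (by linarith)
  have e2 := h3 y' hy (b - ε / 2) (b + ε / 2) (by linarith) (by linarith) (by linarith)
    (by linarith)
  have := hρ.box (show b - ε / 2 ≤ b + ε / 2 by linarith) (show b + ε / 2 ≤ y by linarith) hy
  omega

theorem IsRankFunction.deathFn_mono {d x x' : ℝ} (hx : x ≤ x') (hd : x' < d) :
    deathFn ρ d x ≤ deathFn ρ d x' := by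
  obtain ⟨ε, h1, h2, h3⟩ := hρ.exists_deathFn_eq hd
  have e1 := h3 x hx (d - ε / 2) (d + ε / 2) (by linarith) (by linarith) (by linarith)
    (by linarith)
  have e2 := h3 x' le_rfl (d - ε / 2) (d + ε / 2) (by linarith) (by linarith) (by linarith)
    (by linarith)
  have := hρ.box hx (show x' ≤ d - ε / 2 by linarith) (show d - ε / 2 ≤ d + ε / 2 by linarith)
  omega

theorem IsRankFunction.deathFn_zero {d x : ℝ} (hx : x < r) (hd : x < d) : deathFn ρ d x = 0 := by
  obtain ⟨ε, h1, h2, h3⟩ := hρ.exists_deathFn_eq hd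
  have := h3 x le_rfl (d - ε / 2) (d + ε / 2) (by linarith) (by linarith) (by linarith)
    (by linarith)
  rw [hρ.zero hx, hρ.zero hx] at this
  exact this

theorem IsRankFunction.exists_rankMult_eq {b d : ℝ} (hbd : b < d) :
    ∃ ε > 0, b + ε ≤ d - ε ∧ ∀ x₀ x₁ y₀ y₁, b - ε < x₀ → x₀ < b → b < x₁ → x₁ < b + ε →
      d - ε < y₀ → y₀ < d → d < y₁ → y₁ < d + ε →
      rankMult ρ (b, d) + (ρ x₀ y₀ + ρ x₁ y₁) = ρ x₁ y₀ + ρ x₀ y₁ := by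
  -- The midpoint separates the two variables: first arguments stay below it and second arguments
  -- above it.
  obtain ⟨ε₁, h1, h2, h3⟩ := hρ.exists_const_birth (show b < (b + d) / 2 by linarith)
  obtain ⟨ε₂, h4, h5, h6⟩ := hρ.exists_const_death (show (b + d) / 2 < d by linarith)
  have m1 := min_le_left ε₁ ε₂
  have m2 := min_le_right ε₁ ε₂
  have hε := lt_min h1 h4
  refine ⟨min ε₁ ε₂, hε, by linarith, ?_⟩
  generalize min ε₁ ε₂ = ε at *
  have cst : ∀ x₀ x₁ y₀ y₁ x₀' x₁' y₀' y₁', b - ε < x₀ → x₀ < b → b < x₁ → x₁ < b + ε →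
      d - ε < y₀ → y₀ < d → d < y₁ → y₁ < d + ε → b - ε < x₀' → x₀' < b → b < x₁' → x₁' < b + ε →
      d - ε < y₀' → y₀' < d → d < y₁' → y₁' < d + ε →
      ρ x₀ y₀ = ρ x₀' y₀' ∧ ρ x₁ y₀ = ρ x₁' y₀' ∧ ρ x₀ y₁ = ρ x₀' y₁' ∧ ρ x₁ y₁ = ρ x₁' y₁' := by
    intro x₀ x₁ y₀ y₁ x₀' x₁' y₀' y₁' a1 a2 a3 a4 a5 a6 a7 a8 b1 b2 b3 b4 b5 b6 b7 b8
    refine ⟨?_, ?_, ?_, ?_⟩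
    · exact ((h3 y₀ (by linarith)).2 x₀ x₀' (by linarith) a2 (by linarith) b2).trans
        ((h6 x₀' (by linarith)).2 y₀ y₀' (by linarith) a6 (by linarith) b6)
    · exact ((h3 y₀ (by linarith)).1 x₁ x₁' a3 (by linarith) b3 (by linarith)).trans
        ((h6 x₁' (by linarith)).2 y₀ y₀' (by linarith) a6 (by linarith) b6)
    · exact ((h3 y₁ (by linarith)).2 x₀ x₀' (by linarith) a2 (by linarith) b2).trans
        ((h6 x₀' (by linarith)).1 y₁ y₁' a7 (by linarith) b7 (by linarith))
    · exact ((h3 y₁ (by linarith)).1 x₁ x₁' a3 (by linarith) b3 (by linarith)).trans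
        ((h6 x₁' (by linarith)).1 y₁ y₁' a7 (by linarith) b7 (by linarith))
  intro x₀ x₁ y₀ y₁ a1 a2 a3 a4 a5 a6 a7 a8
  have hbox := hρ.box (show x₀ ≤ x₁ by linarith) (show x₁ ≤ y₀ by linarith)
    (show y₀ ≤ y₁ by linarith)
  have : rankMult ρ (b, d) = (ρ x₁ y₀ + ρ x₀ y₁) - (ρ x₀ y₀ + ρ x₁ y₁) := by
    rw [rankMult, if_pos hbd]
    refine le_antisymm (Nat.sInf_le ⟨ε / 2, by linarith, by dsimp; linarith, ?_⟩) ?_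
    · obtain ⟨c1, c2, c3, c4⟩ := cst x₀ x₁ y₀ y₁ (b - ε / 2) (b + ε / 2) (d - ε / 2) (d + ε / 2)
        a1 a2 a3 a4 a5 a6 a7 a8 (by linarith) (by linarith) (by linarith) (by linarith)
        (by linarith) (by linarith) (by linarith) (by linarith)
      rw [c1, c2, c3, c4]
    · refine le_csInf ⟨_, ε / 2, by linarith, by dsimp; linarith, rfl⟩ ?_
      rintro m ⟨ε', e1, e2, rfl⟩
      dsimp only at e2 ⊢
      have n1 := min_le_left ε' (ε / 2)
      have n2 := min_le_right ε' (ε / 2)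
      have n3 : 0 < min ε' (ε / 2) := lt_min e1 (by linarith)
      generalize min ε' (ε / 2) = κ at n1 n2 n3
      obtain ⟨c1, c2, c3, c4⟩ := cst x₀ x₁ y₀ y₁ (b - κ) (b + κ) (d - κ) (d + κ)
        a1 a2 a3 a4 a5 a6 a7 a8 (by linarith) (by linarith) (by linarith) (by linarith)
        (by linarith) (by linarith) (by linarith) (by linarith)
      -- The larger square is the smaller one together with four rectangles, each of nonnegative
      -- mass.
      have g1 := hρ.box (show b - ε' ≤ b - κ by linarith) (show b - κ ≤ d - ε' by linarith)
        (show d - ε' ≤ d + ε' by linarith)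
      have g2 := hρ.box (show b + κ ≤ b + ε' by linarith) (show b + ε' ≤ d - ε' by linarith)
        (show d - ε' ≤ d + ε' by linarith)
      have g3 := hρ.box (show b - κ ≤ b + κ by linarith) (show b + κ ≤ d - ε' by linarith)
        (show d - ε' ≤ d - κ by linarith)
      have g4 := hρ.box (show b - κ ≤ b + κ by linarith) (show b + κ ≤ d + κ by linarith)
        (show d + κ ≤ d + ε' by linarith)
      omega
  omega

/-- The count in a small rectangle is the difference of two strip counts, taken at its two heights.
So the points with birth `b` are the jumps of one monotone function. -/
theorem IsRankFunction.rankMult_add_birthFn {b d : ℝ} (hbd : b < d) :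
    ∃ ε > 0, b ≤ d - ε ∧ ∀ y₀ y₁, d - ε < y₀ → y₀ < d → d < y₁ → y₁ < d + ε →
      rankMult ρ (b, d) + birthFn ρ b y₁ = birthFn ρ b y₀ := by
  obtain ⟨ε, h1, h2, h3⟩ := hρ.exists_rankMult_eq hbd
  obtain ⟨ε', h4, h5, h6⟩ := hρ.exists_birthFn_eq (show b < d - ε by linarith)
  refine ⟨ε, h1, by linarith, fun y₀ y₁ a1 a2 a3 a4 => ?_⟩
  have m1 := min_le_left ε ε'
  have m2 := min_le_right ε ε'
  have m3 := lt_min h1 h4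
  generalize min ε ε' = κ at m1 m2 m3
  have e1 := h6 y₀ (by linarith) (b - κ / 2) (b + κ / 2) (by linarith) (by linarith) (by linarith)
    (by linarith)
  have e2 := h6 y₁ (by linarith) (b - κ / 2) (b + κ / 2) (by linarith) (by linarith) (by linarith)
    (by linarith)
  have e3 := h3 (b - κ / 2) (b + κ / 2) y₀ y₁ (by linarith) (by linarith) (by linarith)
    (by linarith) a1 a2 a3 a4
  omega

theorem IsRankFunction.rankMult_add_deathFn {b d : ℝ} (hbd : b < d) :
    ∃ ε > 0, b + ε ≤ d ∧ ∀ x₀ x₁, b - ε < x₀ → x₀ < b → b < x₁ → x₁ < b + ε →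
      rankMult ρ (b, d) + deathFn ρ d x₀ = deathFn ρ d x₁ := by
  obtain ⟨ε, h1, h2, h3⟩ := hρ.exists_rankMult_eq hbd
  obtain ⟨ε', h4, h5, h6⟩ := hρ.exists_deathFn_eq (show b + ε < d by linarith)
  refine ⟨ε, h1, by linarith, fun x₀ x₁ a1 a2 a3 a4 => ?_⟩
  have m1 := min_le_left ε ε'
  have m2 := min_le_right ε ε'
  have m3 := lt_min h1 h4
  generalize min ε ε' = κ at m1 m2 m3
  have e1 := h6 x₀ (by linarith) (d - κ / 2) (d + κ / 2) (by linarith) (by linarith) (by linarith)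
    (by linarith)
  have e2 := h6 x₁ (by linarith) (d - κ / 2) (d + κ / 2) (by linarith) (by linarith) (by linarith)
    (by linarith)
  have e3 := h3 x₀ x₁ (d - κ / 2) (d + κ / 2) a1 a2 a3 a4 (by linarith) (by linarith)
    (by linarith) (by linarith)
  omega

omit hρ in
theorem essFn_le {x y : ℝ} (h : x ≤ y) : essFn ρ x ≤ ρ x y := Nat.sInf_le ⟨y, h, rfl⟩

omit hρ in
theorem exists_essFn_eq (ρ : ℝ → ℝ → ℕ) (x : ℝ) : ∃ y, x ≤ y ∧ essFn ρ x = ρ x y :=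
  Nat.sInf_mem (s := {m | ∃ y : ℝ, x ≤ y ∧ m = ρ x y}) ⟨_, x, le_rfl, rfl⟩

theorem IsRankFunction.exists_essFn_eq_of_le (x : ℝ) : ∃ Y, ∀ y, Y ≤ y → essFn ρ x = ρ x y := by
  obtain ⟨Y, h1, h2⟩ := exists_essFn_eq ρ x
  exact ⟨Y, fun y hy => le_antisymm (essFn_le (by linarith))
    (h2 ▸ hρ.anti h1 hy)⟩

theorem IsRankFunction.essFn_mono : Monotone (essFn ρ) := by
  intro x x' h
  obtain ⟨Y, h1, h2⟩ := exists_essFn_eq ρ x'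
  rw [h2]
  exact (essFn_le (h.trans h1)).trans (hρ.mono h h1)

theorem IsRankFunction.essFn_zero {x : ℝ} (hx : x < r) : essFn ρ x = 0 :=
  Nat.le_zero.1 (hρ.zero hx ▸ essFn_le (le_refl x))

theorem IsRankFunction.rankEss_add_essFn (b : ℝ) :
    ∃ ε > 0, ∀ x₀ x₁, b - ε < x₀ → x₀ < b → b < x₁ → x₁ < b + ε →
      rankEss ρ b + essFn ρ x₀ = essFn ρ x₁ := by
  obtain ⟨ε, h1, h2, h3⟩ := hρ.exists_birthFn_eq (lt_add_one b)
  refine ⟨ε, h1, fun x₀ x₁ a1 a2 a3 a4 => ?_⟩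
  obtain ⟨Y₀, h4⟩ := hρ.exists_essFn_eq_of_le x₀
  obtain ⟨Y₁, h5⟩ := hρ.exists_essFn_eq_of_le x₁
  obtain ⟨ε', t, h6, h7, h8⟩ := Nat.sInf_mem
    (s := {m | ∃ ε t : ℝ, 0 < ε ∧ b + ε ≤ t ∧ m = ρ (b + ε) t - ρ (b - ε) t})
    ⟨_, 1, b + 1, one_pos, le_rfl, rfl⟩
  -- At such a height `ρ x₀` and `ρ x₁` have reached their limits and `t`, where the infimum in
  -- `rankEss` is attained, has been passed; hence `birthFn ρ b Y = rankEss ρ b`.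
  obtain ⟨Y, k1, k2, k3, k4⟩ : ∃ Y, Y₀ ≤ Y ∧ Y₁ ≤ Y ∧ t ≤ Y ∧ b + 1 ≤ Y :=
    ⟨max (max Y₀ Y₁) (max t (b + 1)), by simp, by simp, by simp, by simp⟩
  rw [h4 Y k1, h5 Y k2]
  have e1 := h3 Y k4 x₀ x₁ a1 a2 a3 a4
  have e2 := h3 Y k4 (b - ε / 2) (b + ε / 2) (by linarith) (by linarith) (by linarith)
    (by linarith)
  have e3 : rankEss ρ b ≤ birthFn ρ b Y := by
    refine Nat.sInf_le ⟨ε / 2, Y, by linarith, by linarith, by omega⟩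
  have e4 : birthFn ρ b Y ≤ rankEss ρ b :=
    (hρ.birthFn_anti (by linarith) k3).trans (by
      rw [rankEss, h8]
      exact Nat.sInf_le ⟨b - ε', b + ε', by linarith, by linarith, h7, rfl⟩)
  omega

end RankFunction

/-! ### Parametrising the points of a diagram by levels -/

/-- The points of the jump measure `j` of a monotone `ℕ`-valued function, counted with
multiplicity, are parametrised by the levels that the function crosses. -/
theorem exists_base_of_monotoneOn {S : Set ℝ} (hS : S.OrdConnected) {φ j : ℝ → ℕ}
    (hφ : MonotoneOn φ S)
    (hj : ∀ x ∈ S, ∃ ε > 0, Set.Ioo (x - ε) (x + ε) ⊆ S ∧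
      ∀ x₀ x₁, x - ε < x₀ → x₀ < x → x < x₁ → x₁ < x + ε → j x + φ x₀ = φ x₁) :
    ∃ base : ℝ → ℕ,
      (∀ x ∈ S, ∀ y ∈ S, y < x → φ y ≤ base x) ∧
      (∀ x ∈ S, ∀ y ∈ S, x < y → base x + j x ≤ φ y) ∧
      ∀ n, ∀ x₁ ∈ S, ∀ x₂ ∈ S, φ x₁ ≤ n → n < φ x₂ → ∃ x ∈ S, base x ≤ n ∧ n < base x + j x := by
  -- `A` is the left limit of `φ` at `x`, so the levels crossed at `x` are `A, …, A + j x - 1`.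
  have h : ∀ x, ∃ A : ℕ, x ∈ S → ∃ ε > 0, Set.Ioo (x - ε) (x + ε) ⊆ S ∧
      (∀ x₀, x - ε < x₀ → x₀ < x → φ x₀ = A) ∧ ∀ x₁, x < x₁ → x₁ < x + ε → φ x₁ = A + j x := by
    intro x
    by_cases hx : x ∈ S
    · obtain ⟨ε, h1, h2, h3⟩ := hj x hx
      refine ⟨φ (x - ε / 2), fun _ => ⟨ε, h1, h2, fun x₀ a1 a2 => ?_, fun x₁ a1 a2 => ?_⟩⟩
      · have e1 := h3 x₀ (x + ε / 2) a1 a2 (by linarith) (by linarith)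
        have e2 := h3 (x - ε / 2) (x + ε / 2) (by linarith) (by linarith) (by linarith)
          (by linarith)
        omega
      · have e1 := h3 (x - ε / 2) x₁ (by linarith) (by linarith) a1 a2
        omega
    · exact ⟨0, fun h => (hx h).elim⟩
  choose base hb using h
  refine ⟨base, ?_, ?_, ?_⟩
  · intro x hx y hy hyx
    obtain ⟨ε, h1, h2, h3, -⟩ := hb x hx
    have m1 : max y (x - ε / 2) < x := max_lt hyx (by linarith)
    have m2 := le_max_right y (x - ε / 2)
    rw [← h3 (max y (x - ε / 2)) (by linarith) m1]
    exact hφ hy (h2 ⟨by linarith, by linarith⟩) (le_max_left _ _)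
  · intro x hx y hy hyx
    obtain ⟨ε, h1, h2, -, h3⟩ := hb x hx
    have m1 : x < min y (x + ε / 2) := lt_min hyx (by linarith)
    have m2 := min_le_right y (x + ε / 2)
    rw [← h3 (min y (x + ε / 2)) m1 (by linarith)]
    exact hφ (h2 ⟨by linarith, by linarith⟩) hy (min_le_left _ _)
  · intro n x₁ hx₁ x₂ hx₂ h₁ h₂
    have hub : ∀ y ∈ {y ∈ S | φ y ≤ n}, y ≤ x₂ := by
      rintro y ⟨hy, hyn⟩
      by_contra hlt
      exact absurd (hφ hx₂ hy (not_le.1 hlt).le) (by omega)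
    have hne : {y ∈ S | φ y ≤ n}.Nonempty := ⟨x₁, hx₁, h₁⟩
    -- Level `n` is crossed at the supremum of the points where `φ ≤ n`.
    have hx : sSup {y ∈ S | φ y ≤ n} ∈ S :=
      hS.out hx₁ hx₂ ⟨le_csSup ⟨x₂, hub⟩ ⟨hx₁, h₁⟩, csSup_le hne hub⟩
    refine ⟨_, hx, ?_⟩
    obtain ⟨ε, h1, h2, h3, h4⟩ := hb _ hx
    generalize hX : sSup {y ∈ S | φ y ≤ n} = x at *
    constructor
    · obtain ⟨y, ⟨hy, hyn⟩, hlt⟩ := exists_lt_of_lt_csSup hne (show x - ε / 2 < _ by rw [hX]; linarith)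
      rw [← h3 (x - ε / 2) (by linarith) (by linarith)]
      exact (hφ (h2 ⟨by linarith, by linarith⟩) hy hlt.le).trans hyn
    · have hmem : x + ε / 2 ∈ S := h2 ⟨by linarith, by linarith⟩
      have : ¬ φ (x + ε / 2) ≤ n := fun hle => by
        have := le_csSup ⟨x₂, hub⟩ (show x + ε / 2 ∈ {y ∈ S | φ y ≤ n} from ⟨hmem, hle⟩)
        linarith
      rw [← h4 (x + ε / 2) (by linarith) (by linarith)]
      omega

/-- The blocks of levels of two distinct points are disjoint, being separated by the value of `φ` at
their midpoint. -/
theorem eq_of_base_add_eq {S : Set ℝ} (hS : S.OrdConnected) {φ j base : ℝ → ℕ}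
    (h₁ : ∀ x ∈ S, ∀ y ∈ S, y < x → φ y ≤ base x)
    (h₂ : ∀ x ∈ S, ∀ y ∈ S, x < y → base x + j x ≤ φ y) {x x' : ℝ} (hx : x ∈ S) (hx' : x' ∈ S)
    {i i' : ℕ} (hi : i < j x) (hi' : i' < j x') (h : base x + i = base x' + i') : x = x' := by
  have main : ∀ {x x' : ℝ}, x ∈ S → x' ∈ S → ∀ {i i' : ℕ}, i < j x → i' < j x' →
      base x + i = base x' + i' → ¬ x < x' := by
    intro x x' hx hx' i i' hi hi' h hlt
    have hm : (x + x') / 2 ∈ S := hS.out hx hx' ⟨by linarith, by linarith⟩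
    have := h₁ x' hx' _ hm (by linarith)
    have := h₂ x hx _ hm (by linarith)
    omega
  exact le_antisymm (not_lt.1 (main hx' hx hi' hi h.symm)) (not_lt.1 (main hx hx' hi hi' h))

theorem rankMult_point_lt {ρ : ℝ → ℝ → ℕ} (p : Points (rankMult ρ)) : p.1.1 < p.1.2 := by
  obtain ⟨⟨b, d⟩, i⟩ := p
  by_contra h
  have h0 : rankMult ρ (b, d) = 0 := if_neg h
  exact absurd (h0 ▸ i).2 (by omega)

theorem Points.ext {α : Type} {m : α → ℕ} {p q : Points m} (h : p.1 = q.1)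
    (h' : (p.2 : ℕ) = q.2) : p = q := by
  obtain ⟨x, i⟩ := p
  obtain ⟨y, j⟩ := q
  obtain rfl : x = y := h
  obtain rfl : i = j := Fin.ext h'
  rfl

section Levels

variable {r : ℝ} {ρ : ℝ → ℝ → ℕ} (hρ : IsRankFunction r ρ)
include hρ

/-- Away from its death, a point of level `n` is alive at `y` exactly when `n < birthFn ρ b y`.
Levels that the function never drops to belong to classes that never die, which is why the last
clause asks for `y₂`. -/
theorem IsRankFunction.exists_birth_levels : ∃ lev : Points (rankMult ρ) → ℕ,
    (∀ p q, p.1.1 = q.1.1 → lev p = lev q → p = q) ∧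
    (∀ p y, p.1.1 < y → y < p.1.2 → lev p < birthFn ρ p.1.1 y) ∧
    (∀ p y, p.1.2 < y → birthFn ρ p.1.1 y ≤ lev p) ∧
    ∀ b n y₁ y₂, b < y₁ → b < y₂ → n < birthFn ρ b y₁ → birthFn ρ b y₂ ≤ n →
      ∃ p, p.1.1 = b ∧ lev p = n := by
  -- The reflection `x ↦ -x` turns the decreasing `birthFn ρ b` into an increasing function.
  have h : ∀ b : ℝ, _ := fun b => exists_base_of_monotoneOn (S := Set.Iio (-b))
    (φ := fun x => birthFn ρ b (-x)) (j := fun x => rankMult ρ (b, -x)) Set.ordConnected_Iio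
    (fun x _ x' hx' hxx' => hρ.birthFn_anti
      (show b < -x' by linarith [Set.mem_Iio.1 hx']) (by linarith))
    (fun x hx => by
      obtain ⟨ε, h1, h2, h3⟩ := hρ.rankMult_add_birthFn
        (show b < -x by linarith [Set.mem_Iio.1 hx])
      exact ⟨ε, h1, fun y hy => Set.mem_Iio.2 (by linarith [hy.2]), fun x₀ x₁ a1 a2 a3 a4 =>
        h3 (-x₁) (-x₀) (by linarith) (by linarith) (by linarith) (by linarith)⟩)
  choose base h₁ h₂ h₃ using h
  refine ⟨fun p => base p.1.1 (-p.1.2) + p.2, ?_, ?_, ?_, ?_⟩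
  · rintro ⟨⟨b, d⟩, i⟩ ⟨⟨b', d'⟩, i'⟩ hb hl
    obtain rfl : b = b' := hb
    have hd : b < d := rankMult_point_lt ⟨(b, d), i⟩
    have hd' : b < d' := rankMult_point_lt ⟨(b, d'), i'⟩
    have := eq_of_base_add_eq (j := fun x => rankMult ρ (b, -x)) Set.ordConnected_Iio (h₁ b) (h₂ b)
      (Set.mem_Iio.2 (neg_lt_neg hd)) (Set.mem_Iio.2 (neg_lt_neg hd'))
      (by simp) (by simp) hl
    obtain rfl : d = d' := neg_injective this
    exact Points.ext rfl (by simpa using hl)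
  · rintro ⟨⟨b, d⟩, i⟩ y hy hyd
    have := h₂ b (-d) (neg_lt_neg (hy.trans hyd)) (-y) (neg_lt_neg hy) (neg_lt_neg hyd)
    simp only [neg_neg] at this
    exact lt_of_lt_of_le (Nat.add_lt_add_left i.2 _) this
  · intro p y hy
    have hp := rankMult_point_lt p
    have := h₁ p.1.1 (-p.1.2) (neg_lt_neg hp) (-y) (neg_lt_neg (hp.trans hy)) (neg_lt_neg hy)
    simp only [neg_neg] at this
    exact this.trans (Nat.le_add_right _ _)
  · intro b n y₁ y₂ hy₁ hy₂ hn hn'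
    obtain ⟨x, hx, l1, l2⟩ := h₃ b n (-y₂) (neg_lt_neg hy₂) (-y₁) (neg_lt_neg hy₁)
      (by simpa using hn') (by simpa using hn)
    refine ⟨⟨(b, -x), ⟨n - base b x, by omega⟩⟩, rfl, ?_⟩
    simp only [neg_neg]
    omega

/-- Here the counting function starts from `0` below `r`, so every level under one of its values is
attained. -/
theorem IsRankFunction.exists_death_levels : ∃ lev : Points (rankMult ρ) → ℕ,
    (∀ p q, p.1.2 = q.1.2 → lev p = lev q → p = q) ∧
    (∀ p x, p.1.1 < x → x < p.1.2 → lev p < deathFn ρ p.1.2 x) ∧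
    (∀ p x, x < p.1.1 → deathFn ρ p.1.2 x ≤ lev p) ∧
    ∀ d n x, x < d → n < deathFn ρ d x → ∃ p, p.1.2 = d ∧ lev p = n := by
  have h : ∀ d : ℝ, _ := fun d => exists_base_of_monotoneOn (S := Set.Iio d)
    (φ := deathFn ρ d) (j := fun x => rankMult ρ (x, d)) Set.ordConnected_Iio
    (fun x _ x' hx' hxx' => hρ.deathFn_mono hxx' hx')
    (fun x hx => by
      obtain ⟨ε, h1, h2, h3⟩ := hρ.rankMult_add_deathFn (Set.mem_Iio.1 hx)
      exact ⟨ε, h1, fun y hy => Set.mem_Iio.2 (by linarith [hy.2]), h3⟩)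
  choose base h₁ h₂ h₃ using h
  refine ⟨fun p => base p.1.2 p.1.1 + p.2, ?_, ?_, ?_, ?_⟩
  · rintro ⟨⟨b, d⟩, i⟩ ⟨⟨b', d'⟩, i'⟩ hd hl
    obtain rfl : d = d' := hd
    have hb : b < d := rankMult_point_lt ⟨(b, d), i⟩
    have hb' : b' < d := rankMult_point_lt ⟨(b', d), i'⟩
    obtain rfl : b = b' := eq_of_base_add_eq (j := fun x => rankMult ρ (x, d)) Set.ordConnected_Iio
      (h₁ d) (h₂ d) hb hb' i.2 i'.2 hl
    exact Points.ext rfl (by simpa using hl)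
  · rintro ⟨⟨b, d⟩, i⟩ x hx hxd
    exact lt_of_lt_of_le (Nat.add_lt_add_left i.2 _) (h₂ d b (hx.trans hxd) x hxd hx)
  · intro p x hx
    have hp := rankMult_point_lt p
    exact (h₁ p.1.2 p.1.1 hp x (hx.trans hp) hx).trans (Nat.le_add_right _ _)
  · intro d n x hx hn
    have m1 := min_le_left (d - 1) (r - 1)
    have m2 := min_le_right (d - 1) (r - 1)
    have hz := hρ.deathFn_zero (show min (d - 1) (r - 1) < r by linarith)
      (show min (d - 1) (r - 1) < d by linarith)
    obtain ⟨x, hx, l1, l2⟩ := h₃ d n (min (d - 1) (r - 1)) (Set.mem_Iio.2 (by linarith)) x hx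
      (by omega) hn
    refine ⟨⟨(x, d), ⟨n - base d x, by omega⟩⟩, rfl, ?_⟩
    simp only
    omega

theorem IsRankFunction.exists_ess_levels : ∃ lev : Points (rankEss ρ) → ℕ,
    Function.Injective lev ∧
    (∀ p x, p.1 < x → lev p < essFn ρ x) ∧
    (∀ p x, x < p.1 → essFn ρ x ≤ lev p) ∧
    ∀ n x, n < essFn ρ x → ∃ p, lev p = n := by
  obtain ⟨base, h₁, h₂, h₃⟩ := exists_base_of_monotoneOn (S := Set.univ)
    (φ := essFn ρ) (j := rankEss ρ) Set.ordConnected_univ (hρ.essFn_mono.monotoneOn _)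
    (fun x _ => by
      obtain ⟨ε, h1, h2⟩ := hρ.rankEss_add_essFn x
      exact ⟨ε, h1, Set.subset_univ _, h2⟩)
  refine ⟨fun p => base p.1 + p.2, ?_, ?_, ?_, ?_⟩
  · rintro ⟨b, i⟩ ⟨b', i'⟩ hl
    obtain rfl : b = b' := eq_of_base_add_eq Set.ordConnected_univ h₁ h₂ trivial trivial i.2 i'.2 hl
    exact Points.ext rfl (by simpa using hl)
  · rintro ⟨b, i⟩ x hx
    exact lt_of_lt_of_le (Nat.add_lt_add_left i.2 _) (h₂ b trivial x trivial hx)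
  · intro p x hx
    exact (h₁ p.1 trivial x trivial hx).trans (Nat.le_add_right _ _)
  · intro n x hn
    obtain ⟨x, -, l1, l2⟩ := h₃ n (r - 1) trivial x trivial
      (by rw [hρ.essFn_zero (by linarith)]; omega) hn
    exact ⟨⟨x, ⟨n - base x, by omega⟩⟩, by simp only; omega⟩

end Levels

/-! ### Induced matchings -/

section Matching

variable {r r' : ℝ} {ρ ρ' : ℝ → ℝ → ℕ} (hρ : IsRankFunction r ρ) (hρ' : IsRankFunction r' ρ') {κ : ℝ}

include hρ hρ' in
/-- If `ρ` is the rank function of a quotient of a module with rank function `ρ'`, by a submodule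
annihilated by the shift by `κ`, then its points are matched with points of `ρ'` with the same
birth. -/
theorem exists_matching_of_quotient
    (h₁ : ∀ {a a' b}, a ≤ a' → a' ≤ b → ρ a' b + ρ' a b ≤ ρ a b + ρ' a' b)
    (h₂ : ∀ {a a' b}, a ≤ a' → a' ≤ b → ρ' a' (b + κ) + ρ a b ≤ ρ' a (b + κ) + ρ a' b)
    (hκ : 0 ≤ κ) :
    ∃ e : Points (rankMult ρ) → Points (rankMult ρ'), Function.Injective e ∧
      (∀ p, (e p).1.1 = p.1.1 ∧ p.1.2 ≤ (e p).1.2 ∧ (e p).1.2 ≤ p.1.2 + κ) ∧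
      ∀ q, q ∉ Set.range e → q.1.2 - q.1.1 ≤ κ := by
  -- `c₁` and `c₂` are `h₁` and `h₂` in the limit of a thin strip around `b`.
  have c₁ : ∀ {b y}, b < y → birthFn ρ b y ≤ birthFn ρ' b y := by
    intro b y hb
    obtain ⟨ε, e1, e2, e3⟩ := hρ.exists_birthFn_eq hb
    obtain ⟨ε', f1, f2, f3⟩ := hρ'.exists_birthFn_eq hb
    have m1 := min_le_left ε ε'
    have m2 := min_le_right ε ε'
    have m3 := lt_min e1 f1
    generalize min ε ε' = η at m1 m2 m3
    have g1 := e3 y le_rfl (b - η / 2) (b + η / 2) (by linarith) (by linarith) (by linarith)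
      (by linarith)
    have g2 := f3 y le_rfl (b - η / 2) (b + η / 2) (by linarith) (by linarith) (by linarith)
      (by linarith)
    have := h₁ (show b - η / 2 ≤ b + η / 2 by linarith) (show b + η / 2 ≤ y by linarith)
    omega
  have c₂ : ∀ {b y}, b < y → birthFn ρ' b (y + κ) ≤ birthFn ρ b y := by
    intro b y hb
    obtain ⟨ε, e1, e2, e3⟩ := hρ.exists_birthFn_eq hb
    obtain ⟨ε', f1, f2, f3⟩ := hρ'.exists_birthFn_eq hb
    have m1 := min_le_left ε ε'
    have m2 := min_le_right ε ε'
    have m3 := lt_min e1 f1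
    generalize min ε ε' = η at m1 m2 m3
    have g1 := e3 y le_rfl (b - η / 2) (b + η / 2) (by linarith) (by linarith) (by linarith)
      (by linarith)
    have g2 := f3 (y + κ) (by linarith) (b - η / 2) (b + η / 2) (by linarith) (by linarith)
      (by linarith) (by linarith)
    have := h₂ (show b - η / 2 ≤ b + η / 2 by linarith) (show b + η / 2 ≤ y by linarith)
    omega
  obtain ⟨lev, l1, l2, l3, l4⟩ := hρ.exists_birth_levels
  obtain ⟨lev', k1, k2, k3, k4⟩ := hρ'.exists_birth_levels
  -- The partner has the same birth and the same level. The midpoint of the bar of `p` shows that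
  -- the level occurs for `ρ'`, a height beyond its death that it does not last forever.
  have ex : ∀ p : Points (rankMult ρ), ∃ q : Points (rankMult ρ'),
      q.1.1 = p.1.1 ∧ lev' q = lev p := by
    intro p
    have hp := rankMult_point_lt p
    exact k4 p.1.1 (lev p) ((p.1.1 + p.1.2) / 2) (p.1.2 + 1 + κ) (by linarith) (by linarith)
      ((l2 p _ (by linarith) (by linarith)).trans_le (c₁ (by linarith)))
      ((c₂ (by linarith)).trans (l3 p _ (by linarith)))
  choose e he he' using ex
  refine ⟨e, fun p q h => ?_, fun p => ⟨he p, ?_, ?_⟩, fun q hq => ?_⟩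
  · exact l1 p q (by rw [← he p, ← he q, h]) (by rw [← he' p, ← he' q, h])
  -- The tests below use points strictly between the values compared, since levels say nothing at
  -- the death itself.
  · by_contra! hlt
    have hq := rankMult_point_lt (e p)
    rw [he p] at hq
    have a1 := l2 p (((e p).1.2 + p.1.2) / 2) (by linarith) (by linarith)
    have a2 := k3 (e p) (((e p).1.2 + p.1.2) / 2) (by linarith)
    rw [he, he'] at a2
    have := c₁ (b := p.1.1) (y := ((e p).1.2 + p.1.2) / 2) (by linarith)
    omega
  · by_contra! hlt
    have hp := rankMult_point_lt p
    have a1 := l3 p ((p.1.2 + ((e p).1.2 - κ)) / 2) (by linarith)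
    have a2 := k2 (e p) ((p.1.2 + ((e p).1.2 - κ)) / 2 + κ) (by rw [he]; linarith) (by linarith)
    rw [he, he'] at a2
    have := c₂ (b := p.1.1) (y := (p.1.2 + ((e p).1.2 - κ)) / 2) (by linarith)
    omega
  -- If the bar of `q` were longer than `κ`, its level would occur for `ρ` as well, and the point
  -- there would be sent to `q`.
  · by_contra! hlt
    have a1 := k2 q ((q.1.1 + (q.1.2 - κ)) / 2 + κ) (by linarith) (by linarith)
    have a2 := k3 q (q.1.2 + 1) (by linarith)
    obtain ⟨p, hp, hp'⟩ := l4 q.1.1 (lev' q) ((q.1.1 + (q.1.2 - κ)) / 2) (q.1.2 + 1) (by linarith)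
      (by linarith) (a1.trans_le (c₂ (by linarith))) ((c₁ (by linarith)).trans a2)
    exact hq ⟨p, k1 _ _ ((he p).trans hp) ((he' p).trans hp')⟩

include hρ hρ' in
/-- If `ρ` is the rank function of a submodule of the shift by `κ` of a module with rank
function `ρ'`, and the quotient is annihilated by the shift by `2 κ`, then the points of `ρ` are
matched with points of `ρ'` with the same death, up to the shift. -/
theorem exists_matching_of_submodule
    (h₁ : ∀ {a b b'}, a ≤ b → b ≤ b' →
      ρ a b + ρ' (a + κ) (b' + κ) ≤ ρ a b' + ρ' (a + κ) (b + κ))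
    (h₂ : ∀ {a b b'}, a ≤ b → b ≤ b' →
      ρ' (a - κ) (b + κ) + ρ a b' ≤ ρ' (a - κ) (b' + κ) + ρ a b)
    (hκ : 0 ≤ κ) :
    ∃ e : Points (rankMult ρ) → Points (rankMult ρ'), Function.Injective e ∧
      (∀ p, (e p).1.2 = p.1.2 + κ ∧ p.1.1 - κ ≤ (e p).1.1 ∧ (e p).1.1 ≤ p.1.1 + κ) ∧
      ∀ q, q ∉ Set.range e → q.1.2 - q.1.1 ≤ 2 * κ := by
  have c₁ : ∀ {d x}, x < d → deathFn ρ d x ≤ deathFn ρ' (d + κ) (x + κ) := by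
    intro d x hd
    obtain ⟨ε, e1, e2, e3⟩ := hρ.exists_deathFn_eq hd
    obtain ⟨ε', f1, f2, f3⟩ := hρ'.exists_deathFn_eq (show x + κ < d + κ by linarith)
    have m1 := min_le_left ε ε'
    have m2 := min_le_right ε ε'
    have m3 := lt_min e1 f1
    generalize min ε ε' = η at m1 m2 m3
    have g1 := e3 x le_rfl (d - η / 2) (d + η / 2) (by linarith) (by linarith) (by linarith)
      (by linarith)
    have g2 := f3 (x + κ) le_rfl (d - η / 2 + κ) (d + η / 2 + κ) (by linarith) (by linarith)
      (by linarith) (by linarith)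
    have := h₁ (show x ≤ d - η / 2 by linarith) (show d - η / 2 ≤ d + η / 2 by linarith)
    omega
  have c₂ : ∀ {d x}, x < d → deathFn ρ' (d + κ) (x - κ) ≤ deathFn ρ d x := by
    intro d x hd
    obtain ⟨ε, e1, e2, e3⟩ := hρ.exists_deathFn_eq hd
    obtain ⟨ε', f1, f2, f3⟩ := hρ'.exists_deathFn_eq (show x + κ < d + κ by linarith)
    have m1 := min_le_left ε ε'
    have m2 := min_le_right ε ε'
    have m3 := lt_min e1 f1
    generalize min ε ε' = η at m1 m2 m3
    have g1 := e3 x le_rfl (d - η / 2) (d + η / 2) (by linarith) (by linarith) (by linarith)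
      (by linarith)
    have g2 := f3 (x - κ) (by linarith) (d - η / 2 + κ) (d + η / 2 + κ) (by linarith) (by linarith)
      (by linarith) (by linarith)
    have := h₂ (show x ≤ d - η / 2 by linarith) (show d - η / 2 ≤ d + η / 2 by linarith)
    omega
  obtain ⟨lev, l1, l2, l3, l4⟩ := hρ.exists_death_levels
  obtain ⟨lev', k1, k2, k3, k4⟩ := hρ'.exists_death_levels
  have ex : ∀ p : Points (rankMult ρ), ∃ q : Points (rankMult ρ'),
      q.1.2 = p.1.2 + κ ∧ lev' q = lev p := by
    intro p
    have hp := rankMult_point_lt p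
    exact k4 _ (lev p) ((p.1.1 + p.1.2) / 2 + κ) (by linarith)
      ((l2 p _ (by linarith) (by linarith)).trans_le (c₁ (by linarith)))
  choose e he he' using ex
  refine ⟨e, fun p q h => ?_, fun p => ⟨he p, ?_, ?_⟩, fun q hq => ?_⟩
  · exact l1 p q (add_right_cancel (b := κ) (by rw [← he p, ← he q, h])) (by rw [← he' p, ← he' q, h])
  · by_contra! hlt
    have hp := rankMult_point_lt p
    have a1 := l3 p (((e p).1.1 + κ + p.1.1) / 2) (by linarith)
    have a2 := k2 (e p) (((e p).1.1 + κ + p.1.1) / 2 - κ) (by linarith) (by rw [he]; linarith)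
    rw [he, he'] at a2
    have := c₂ (d := p.1.2) (x := ((e p).1.1 + κ + p.1.1) / 2) (by linarith)
    omega
  · by_contra! hlt
    have hq := rankMult_point_lt (e p)
    rw [he p] at hq
    have a1 := l2 p (((e p).1.1 - κ + p.1.1) / 2) (by linarith) (by linarith)
    have a2 := k3 (e p) (((e p).1.1 - κ + p.1.1) / 2 + κ) (by linarith)
    rw [he, he'] at a2
    have := c₁ (d := p.1.2) (x := ((e p).1.1 - κ + p.1.1) / 2) (by linarith)
    omega
  -- The level of a bar longer than `2 * κ` is tested halfway between its birth and its death minus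
  -- `2 * κ`; by `c₂` it occurs for `ρ` at the death `q.1.2 - κ`.
  · by_contra! hlt
    have a1 := k2 q ((q.1.1 + (q.1.2 - 2 * κ)) / 2) (by linarith) (by linarith)
    have a2 := c₂ (d := q.1.2 - κ) (x := (q.1.1 + (q.1.2 - 2 * κ)) / 2 + κ) (by linarith)
    simp only [sub_add_cancel, add_sub_cancel_right] at a2
    obtain ⟨p, hp, hp'⟩ := l4 (q.1.2 - κ) (lev' q) _ (by linarith) (a1.trans_le a2)
    exact hq ⟨p, k1 _ _ (by rw [he, hp, sub_add_cancel]) ((he' p).trans hp')⟩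

include hρ hρ' in
-- Letting the second argument grow gives `essFn ρ x ≤ essFn ρ' (x + κ)` and conversely. Both sides
-- therefore attain the same levels, so matching by level is a bijection.
theorem exists_essential_matching
    (h₁ : ∀ {a b}, a ≤ b → ρ a (b + 2 * κ) ≤ ρ' (a + κ) (b + κ))
    (h₂ : ∀ {a b}, a ≤ b → ρ' a (b + 2 * κ) ≤ ρ (a + κ) (b + κ)) (hκ : 0 ≤ κ) :
    ∃ e : Points (rankEss ρ) ≃ Points (rankEss ρ'), ∀ p, |p.1 - (e p).1| ≤ κ := by
  have main : ∀ {σ σ' : ℝ → ℝ → ℕ}, (∀ {a b}, a ≤ b → σ a (b + 2 * κ) ≤ σ' (a + κ) (b + κ)) →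
      ∀ x, essFn σ x ≤ essFn σ' (x + κ) := by
    intro σ σ' h x
    obtain ⟨y, hy, hy'⟩ := exists_essFn_eq σ' (x + κ)
    rw [hy']
    refine (essFn_le (y := y - κ + 2 * κ) (by linarith)).trans ?_
    simpa using h (show x ≤ y - κ by linarith)
  have c₁ := main h₁
  have c₂ := main h₂
  obtain ⟨lev, l1, l2, l3, l4⟩ := hρ.exists_ess_levels
  obtain ⟨lev', k1, k2, k3, k4⟩ := hρ'.exists_ess_levels
  have ex : ∀ p : Points (rankEss ρ), ∃ q : Points (rankEss ρ'), lev' q = lev p := fun p =>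
    k4 _ (p.1 + 1 + κ) ((l2 p _ (lt_add_one _)).trans_le (c₁ _))
  have ex' : ∀ q : Points (rankEss ρ'), ∃ p : Points (rankEss ρ), lev p = lev' q := fun q =>
    l4 _ (q.1 + 1 + κ) ((k2 q _ (lt_add_one _)).trans_le (c₂ _))
  choose e he using ex
  have hbij : Function.Bijective e := by
    refine ⟨fun p q h => l1 (by rw [← he, ← he, h]), fun q => ?_⟩
    obtain ⟨p, hp⟩ := ex' q
    exact ⟨p, k1 ((he p).trans hp)⟩
  refine ⟨Equiv.ofBijective e hbij, fun p => ?_⟩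
  rw [Equiv.ofBijective_apply, abs_le]
  constructor
  · by_contra! hlt
    have a1 := l2 p (((e p).1 - κ + p.1) / 2) (by linarith)
    have a2 := k3 (e p) (((e p).1 - κ + p.1) / 2 + κ) (by linarith)
    have := c₁ (((e p).1 - κ + p.1) / 2)
    have := he p
    omega
  · by_contra! hlt
    have a1 := k2 (e p) (((e p).1 + (p.1 - κ)) / 2) (by linarith)
    have a2 := l3 p (((e p).1 + (p.1 - κ)) / 2 + κ) (by linarith)
    have := c₂ (((e p).1 + (p.1 - κ)) / 2)
    have := he p
    omega

end Matching

/-- A span of injections is a partial matching. -/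
theorem exists_pequiv_of_injective {A B C : Type} {e : A → B} {e' : A → C}
    (he : Function.Injective e) (he' : Function.Injective e') :
    ∃ μ : B ≃. C, (∀ b c, c ∈ μ b → ∃ a, e a = b ∧ e' a = c) ∧
      (∀ b, μ b = none → b ∉ Set.range e) ∧ ∀ c, μ.symm c = none → c ∉ Set.range e' := by
  classical
  have key : ∀ {B C : Type} {e : A → B} {e' : A → C}, Function.Injective e →
      ∀ b c, c ∈ (if h : ∃ a, e a = b then some (e' h.choose) else none) ↔
        ∃ a, e a = b ∧ e' a = c := by
    intro B C e e' he b c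
    split_ifs with h
    · rw [Option.mem_some_iff]
      refine ⟨fun hc => ⟨_, h.choose_spec, hc⟩, ?_⟩
      rintro ⟨a, rfl, rfl⟩
      rw [he h.choose_spec]
    · simp only [Option.mem_def, reduceCtorEq, false_iff]
      exact fun ⟨a, ha, _⟩ => h ⟨a, ha⟩
  refine ⟨⟨fun b => if h : ∃ a, e a = b then some (e' h.choose) else none,
    fun c => if h : ∃ a, e' a = c then some (e h.choose) else none, fun b c => ?_⟩, ?_, ?_, ?_⟩
  · exact (key he' c b).trans ((exists_congr fun a => and_comm).trans (key he b c).symm)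
  · exact fun b c => (key he b c).1
  · rintro b hb ⟨a, ha⟩
    have : e' a ∈ (none : Option C) := hb ▸ (key he b (e' a)).2 ⟨a, ha, rfl⟩
    exact absurd this (by simp)
  · rintro c hc ⟨a, ha⟩
    have : e a ∈ (none : Option B) := hc ▸ (key he' c (e a)).2 ⟨a, ha, rfl⟩
    exact absurd this (by simp)

/-! ### Interleaved persistence modules -/

/-- The dimension lost by `R` under `T` is that of `R ⊓ ker T`, which grows with `R`. All box
inequalities and all comparisons of ranks under an interleaving with four terms come from this. -/
theorem finrank_add_finrank_map_le {F V V' : Type*} [Field F] [AddCommGroup V] [Module F V]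
    [AddCommGroup V'] [Module F V'] [Module.Finite F V] (T : V →ₗ[F] V') {P Q : Submodule F V}
    (h : P ≤ Q) :
    Module.finrank F P + Module.finrank F (Q.map T) ≤
      Module.finrank F Q + Module.finrank F (P.map T) := by
  have key : ∀ R : Submodule F V, Module.finrank F (R.map T) +
      Module.finrank F (R ⊓ LinearMap.ker T : Submodule F V) = Module.finrank F R := by
    intro R
    have := LinearMap.finrank_range_add_finrank_ker (T.domRestrict R)
    rwa [LinearMap.range_domRestrict, LinearMap.ker_domRestrict,
      ← Submodule.finrank_map_subtype_eq, Submodule.map_comap_subtype] at this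
  have h1 := key P
  have h2 := key Q
  have h3 := Submodule.finrank_mono (inf_le_inf_right (LinearMap.ker T) h)
  omega

section Interleaving

variable {F : Type u} [Field F] {r : ℝ}

/-- An interleaving of persistence modules, given by maps for all shifts by at least `η`. -/
structure Interleaving (M N : Set.Ici r ⥤ ModuleCat.{u} F) (η : ℝ) where
  hom : ∀ a b : Set.Ici r, (a : ℝ) + η ≤ b → (M.obj a ⟶ N.obj b)
  inv : ∀ a b : Set.Ici r, (a : ℝ) + η ≤ b → (N.obj a ⟶ M.obj b)
  map_hom : ∀ {a a' b : Set.Ici r} (f : a ⟶ a') (h : (a' : ℝ) + η ≤ b) (h' : (a : ℝ) + η ≤ b),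
    M.map f ≫ hom a' b h = hom a b h'
  hom_map : ∀ {a b b' : Set.Ici r} (f : b ⟶ b') (h : (a : ℝ) + η ≤ b) (h' : (a : ℝ) + η ≤ b'),
    hom a b h ≫ N.map f = hom a b' h'
  map_inv : ∀ {a a' b : Set.Ici r} (f : a ⟶ a') (h : (a' : ℝ) + η ≤ b) (h' : (a : ℝ) + η ≤ b),
    N.map f ≫ inv a' b h = inv a b h'
  inv_map : ∀ {a b b' : Set.Ici r} (f : b ⟶ b') (h : (a : ℝ) + η ≤ b) (h' : (a : ℝ) + η ≤ b'),
    inv a b h ≫ M.map f = inv a b' h'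
  hom_inv : ∀ {a b c : Set.Ici r} (h : (a : ℝ) + η ≤ b) (h' : (b : ℝ) + η ≤ c) (f : a ⟶ c),
    hom a b h ≫ inv b c h' = M.map f
  inv_hom : ∀ {a b c : Set.Ici r} (h : (a : ℝ) + η ≤ b) (h' : (b : ℝ) + η ≤ c) (f : a ⟶ c),
    inv a b h ≫ hom b c h' = N.map f

/-- The reversed interleaving. -/
def Interleaving.symm {M N : Set.Ici r ⥤ ModuleCat.{u} F} {η : ℝ} (I : Interleaving M N η) :
    Interleaving N M η where
  hom := I.inv
  inv := I.hom
  map_hom := I.map_inv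
  hom_map := I.inv_map
  map_inv := I.map_hom
  inv_map := I.hom_map
  hom_inv := I.inv_hom
  inv_hom := I.hom_inv

open Classical in
/-- The image in `M_b` of `M_a`, where `M` vanishes below `r`. -/
def imageSub (M : Set.Ici r ⥤ ModuleCat.{u} F) (a : ℝ) (b : Set.Ici r) : Submodule F (M.obj b) :=
  if h : r ≤ a ∧ a ≤ b then
    LinearMap.range (M.map (homOfLE (show (⟨a, h.1⟩ : Set.Ici r) ≤ b from h.2))).hom
  else ⊥

variable {M N : Set.Ici r ⥤ ModuleCat.{u} F}

theorem imageSub_eq_range {a b : Set.Ici r} (f : a ⟶ b) :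
    imageSub M a b = LinearMap.range (M.map f).hom :=
  dif_pos ⟨a.2, leOfHom f⟩

theorem imageSub_of_lt {a : ℝ} (h : a < r) (b : Set.Ici r) : imageSub M a b = ⊥ :=
  dif_neg fun h' => h.not_ge h'.1

theorem finrank_imageSub (a : ℝ) (b : Set.Ici r) :
    Module.finrank F (imageSub M a b) = persistentRank M a b := by
  by_cases h : r ≤ a ∧ a ≤ b
  · rw [persistentRank, dif_pos h, imageSub, dif_pos h]
  · rw [persistentRank, dif_neg h, imageSub, dif_neg h, finrank_bot]

theorem persistentRank_of_lt {a b : ℝ} (h : a < r) : persistentRank M a b = 0 :=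
  dif_neg fun h' => h.not_ge h'.1

theorem map_imageSub {a : ℝ} {b b' : Set.Ici r} (h : a ≤ b) (f : b ⟶ b') :
    (imageSub M a b).map (M.map f).hom = imageSub M a b' := by
  by_cases ha : r ≤ a
  · rw [imageSub_eq_range (a := ⟨a, ha⟩) (homOfLE h), imageSub_eq_range (a := ⟨a, ha⟩)
      (homOfLE h ≫ f), ← LinearMap.range_comp, Functor.map_comp, ModuleCat.hom_comp]
  · rw [imageSub_of_lt (not_le.1 ha), imageSub_of_lt (not_le.1 ha), Submodule.map_bot]

theorem imageSub_mono {a a' : ℝ} {b : Set.Ici r} (h : a ≤ a') (h' : a' ≤ b) :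
    imageSub M a b ≤ imageSub M a' b := by
  by_cases ha : r ≤ a
  · let x : Set.Ici r := ⟨a, ha⟩
    let x' : Set.Ici r := ⟨a', ha.trans h⟩
    let f : x ⟶ x' := homOfLE h
    let g : x' ⟶ b := homOfLE h'
    rw [imageSub_eq_range (a := x) (f ≫ g), imageSub_eq_range (a := x') g, Functor.map_comp,
      ModuleCat.hom_comp]
    exact LinearMap.range_comp_le_range _ _
  · rw [imageSub_of_lt (not_le.1 ha)]
    exact bot_le

theorem isRankFunction_persistentRank (hM : PointwiseFinite M) :
    IsRankFunction r (persistentRank M) where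
  mono := by
    intro a a' b h h'
    by_cases hb : r ≤ b
    · rw [← finrank_imageSub a ⟨b, hb⟩, ← finrank_imageSub a' ⟨b, hb⟩]
      have := hM ⟨b, hb⟩
      exact Submodule.finrank_mono (imageSub_mono h h')
    · rw [persistentRank_of_lt (by linarith)]
      exact Nat.zero_le _
  anti := by
    intro a b b' h h'
    by_cases hb : r ≤ b
    · have := hM ⟨b, hb⟩
      rw [← finrank_imageSub a ⟨b, hb⟩, ← finrank_imageSub a ⟨b', hb.trans h'⟩,
        ← map_imageSub (b := ⟨b, hb⟩) (b' := ⟨b', hb.trans h'⟩) h (homOfLE h')]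
      exact Submodule.finrank_map_le _ _
    · rw [persistentRank_of_lt (by linarith)]
      exact Nat.zero_le _
  box := by
    intro a a' b b' h h' h''
    by_cases hb : r ≤ b
    · have := hM ⟨b, hb⟩
      rw [← finrank_imageSub a ⟨b, hb⟩, ← finrank_imageSub a ⟨b', hb.trans h''⟩,
        ← finrank_imageSub a' ⟨b, hb⟩, ← finrank_imageSub a' ⟨b', hb.trans h''⟩,
        ← map_imageSub (b := ⟨b, hb⟩) (b' := ⟨b', hb.trans h''⟩) (h.trans h') (homOfLE h''),
        ← map_imageSub (b := ⟨b, hb⟩) (b' := ⟨b', hb.trans h''⟩) h' (homOfLE h'')]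
      have := finrank_add_finrank_map_le (M.map (homOfLE (show (⟨b, hb⟩ : Set.Ici r) ≤
        ⟨b', hb.trans h''⟩ from h''))).hom (imageSub_mono (M := M) (b := ⟨b, hb⟩) h h')
      linarith
    · rw [persistentRank_of_lt (show a' < r by linarith), persistentRank_of_lt (show a < r by linarith)]
      exact Nat.zero_le _
  zero := persistentRank_of_lt

variable {η : ℝ} (I : Interleaving M N η)

/-- The image of `M_a` in `N_c`, through `M_b`. -/
def Interleaving.imageSub (a : ℝ) (b c : Set.Ici r) (h : (b : ℝ) + η ≤ c) :
    Submodule F (N.obj c) :=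
  (MultiMapper.imageSub M a b).map (I.hom b c h).hom

theorem Interleaving.imageSub_eq_range {a b c : Set.Ici r} (h : a ≤ b) (h' : (b : ℝ) + η ≤ c)
    (h'' : (a : ℝ) + η ≤ c) :
    I.imageSub a b c h' = LinearMap.range (I.hom a c h'').hom := by
  rw [Interleaving.imageSub, MultiMapper.imageSub_eq_range (homOfLE h), ← LinearMap.range_comp,
    ← ModuleCat.hom_comp, I.map_hom]

theorem Interleaving.imageSub_of_lt {a : ℝ} (h : a < r) (b c : Set.Ici r) (h' : (b : ℝ) + η ≤ c) :
    I.imageSub a b c h' = ⊥ := by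
  rw [Interleaving.imageSub, MultiMapper.imageSub_of_lt h, Submodule.map_bot]

theorem Interleaving.imageSub_mono {a a' : ℝ} {b c : Set.Ici r} (h : a ≤ a') (h' : a' ≤ b)
    (hc : (b : ℝ) + η ≤ c) : I.imageSub a b c hc ≤ I.imageSub a' b c hc :=
  Submodule.map_mono (MultiMapper.imageSub_mono h h')

theorem Interleaving.map_imageSub {a : ℝ} {b b' c c' : Set.Ici r} (h : a ≤ b) (hb : b ≤ b')
    (hc : c ⟶ c') (h₁ : (b : ℝ) + η ≤ c) (h₂ : (b' : ℝ) + η ≤ c') :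
    (I.imageSub a b c h₁).map (N.map hc).hom = I.imageSub a b' c' h₂ := by
  have h₃ : (b : ℝ) + η ≤ c' := h₁.trans (leOfHom hc)
  rw [Interleaving.imageSub, ← Submodule.map_comp, ← ModuleCat.hom_comp, I.hom_map hc h₁ h₃,
    Interleaving.imageSub, ← MultiMapper.map_imageSub h (homOfLE hb), ← Submodule.map_comp,
    ← ModuleCat.hom_comp, I.map_hom (homOfLE hb) h₂ h₃]

/-- Going back along `inv` recovers a structure map of `M`: this is the bound on the kernel of `M →
N`. -/
theorem Interleaving.map_inv_imageSub {a : ℝ} {b c d : Set.Ici r} (h : a ≤ b) (hbd : b ≤ d)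
    (h₁ : (b : ℝ) + η ≤ c) (h₂ : (c : ℝ) + η ≤ d) :
    (I.imageSub a b c h₁).map (I.inv c d h₂).hom = MultiMapper.imageSub M a d := by
  rw [Interleaving.imageSub, ← Submodule.map_comp, ← ModuleCat.hom_comp,
    I.hom_inv h₁ h₂ (homOfLE hbd), MultiMapper.map_imageSub h]

theorem Interleaving.imageSub_le {a a' : ℝ} {b c : Set.Ici r} (h : a ≤ b) (ha : a + η ≤ a')
    (hη : 0 ≤ η) (h' : a' ≤ c) (hc : (b : ℝ) + η ≤ c) :
    I.imageSub a b c hc ≤ MultiMapper.imageSub N a' c := by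
  by_cases hr : r ≤ a
  · let x : Set.Ici r := ⟨a, hr⟩
    let x' : Set.Ici r := ⟨a', show r ≤ a' by linarith⟩
    rw [I.imageSub_eq_range (a := x) h hc (ha.trans h'),
      MultiMapper.imageSub_eq_range (a := x') (homOfLE h'),
      ← I.hom_map (a := x) (b := x') (homOfLE h') ha (ha.trans h'), ModuleCat.hom_comp]
    exact LinearMap.range_comp_le_range _ _
  · rw [I.imageSub_of_lt (not_le.1 hr)]
    exact bot_le

/-- The structure map of `N` from `a` to `c` factors through `M` at `a'`: this is the bound on the
cokernel. -/
theorem Interleaving.le_imageSub {a a' : ℝ} {b c : Set.Ici r} (h : a' ≤ b) (ha : a + η ≤ a')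
    (hη : 0 ≤ η) (hc : (b : ℝ) + η ≤ c) :
    MultiMapper.imageSub N a c ≤ I.imageSub a' b c hc := by
  by_cases hr : r ≤ a
  · let x : Set.Ici r := ⟨a, hr⟩
    let x' : Set.Ici r := ⟨a', show r ≤ a' by linarith⟩
    have hx : x ≤ c := show a ≤ c by linarith
    rw [I.imageSub_eq_range (a := x') h hc (show a' + η ≤ c by linarith),
      MultiMapper.imageSub_eq_range (a := x) (homOfLE hx),
      ← I.inv_hom (a := x) (b := x') ha (show a' + η ≤ c by linarith), ModuleCat.hom_comp]
    exact LinearMap.range_comp_le_range _ _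
  · rw [MultiMapper.imageSub_of_lt (not_le.1 hr)]
    exact bot_le

open Classical in
/-- The rank function of the image of an interleaving map. -/
def Interleaving.rank (hη : 0 ≤ η) (a b : ℝ) : ℕ :=
  if h : r ≤ b then Module.finrank F
    (I.imageSub a ⟨b, h⟩ ⟨b + η, show r ≤ b + η by linarith⟩ le_rfl) else 0

variable (hη : 0 ≤ η)

theorem Interleaving.rank_of_lt {a : ℝ} (h : a < r) (b : ℝ) : I.rank hη a b = 0 := by
  unfold Interleaving.rank
  split_ifs
  · rw [I.imageSub_of_lt h, finrank_bot]
  · rfl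

theorem Interleaving.rank_eq {a b : ℝ} (h : r ≤ b) : I.rank hη a b = Module.finrank F
    (I.imageSub a ⟨b, h⟩ ⟨b + η, show r ≤ b + η by linarith⟩ le_rfl) :=
  dif_pos h

theorem Interleaving.isRankFunction (hN : PointwiseFinite N) : IsRankFunction r (I.rank hη) where
  mono := by
    intro a a' b h h'
    by_cases hb : r ≤ b
    · rw [I.rank_eq hη hb, I.rank_eq hη hb]
      have := hN ⟨b + η, show r ≤ b + η by linarith⟩
      exact Submodule.finrank_mono (I.imageSub_mono h h' _)
    · rw [I.rank_of_lt hη (by linarith)]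
      exact Nat.zero_le _
  anti := by
    intro a b b' h h'
    by_cases hb : r ≤ b
    · have := hN ⟨b + η, show r ≤ b + η by linarith⟩
      rw [I.rank_eq hη hb, I.rank_eq hη (hb.trans h'),
        ← I.map_imageSub (b := ⟨b, hb⟩) (c := ⟨b + η, show r ≤ b + η by linarith⟩) h h'
          (homOfLE (add_le_add_left h' η)) le_rfl]
      exact Submodule.finrank_map_le _ _
    · rw [I.rank_of_lt hη (by linarith)]
      exact Nat.zero_le _
  box := by
    intro a a' b b' h h' h''
    by_cases hb : r ≤ b
    · let B : Set.Ici r := ⟨b, hb⟩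
      let C : Set.Ici r := ⟨b + η, show r ≤ b + η by linarith⟩
      let C' : Set.Ici r := ⟨b' + η, show r ≤ b' + η by linarith⟩
      let f : C ⟶ C' := homOfLE (add_le_add_left h'' η)
      have := hN C
      have key := finrank_add_finrank_map_le (N.map f).hom
        (I.imageSub_mono (b := B) (c := C) h h' le_rfl)
      rw [I.map_imageSub (b' := ⟨b', hb.trans h''⟩) h' h'' f le_rfl le_rfl,
        I.map_imageSub (b' := ⟨b', hb.trans h''⟩) (h.trans h') h'' f le_rfl le_rfl] at key
      rw [I.rank_eq hη hb, I.rank_eq hη hb, I.rank_eq hη (hb.trans h''),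
        I.rank_eq hη (hb.trans h'')]
      linarith
    · rw [I.rank_of_lt hη (show a' < r by linarith), I.rank_of_lt hη (show a < r by linarith)]
      exact Nat.zero_le _
  zero h := I.rank_of_lt hη h _

/-- This and the next lemma supply the hypotheses of `exists_matching_of_quotient` with `κ = 2 * η`:
subspaces of `M_b` are pushed along `hom`, and their images back along `inv`. -/
theorem Interleaving.rank_add_persistentRank_le (hM : PointwiseFinite M) {a a' b : ℝ}
    (h : a ≤ a') (h' : a' ≤ b) :
    I.rank hη a' b + persistentRank M a b ≤ I.rank hη a b + persistentRank M a' b := by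
  by_cases hb : r ≤ b
  · let B : Set.Ici r := ⟨b, hb⟩
    let C : Set.Ici r := ⟨b + η, show r ≤ b + η by linarith⟩
    have := hM B
    have key := finrank_add_finrank_map_le (I.hom B C le_rfl).hom
      (MultiMapper.imageSub_mono (M := M) (b := B) h h')
    rw [finrank_imageSub, finrank_imageSub] at key
    rw [I.rank_eq hη hb, I.rank_eq hη hb]
    change persistentRank M a b + Module.finrank F (I.imageSub a' B C le_rfl) ≤
      persistentRank M a' b + Module.finrank F (I.imageSub a B C le_rfl) at key
    linarith
  · rw [I.rank_of_lt hη (by linarith), persistentRank_of_lt (by linarith)]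
    exact Nat.zero_le _

theorem Interleaving.persistentRank_add_rank_le (hN : PointwiseFinite N) {a a' b : ℝ}
    (h : a ≤ a') (h' : a' ≤ b) :
    persistentRank M a' (b + 2 * η) + I.rank hη a b ≤
      persistentRank M a (b + 2 * η) + I.rank hη a' b := by
  by_cases hb : r ≤ b
  · let B : Set.Ici r := ⟨b, hb⟩
    let C : Set.Ici r := ⟨b + η, show r ≤ b + η by linarith⟩
    let D : Set.Ici r := ⟨b + 2 * η, show r ≤ b + 2 * η by linarith⟩
    have hBD : B ≤ D := show b ≤ b + 2 * η by linarith
    have hCD : (C : ℝ) + η ≤ D := show b + η + η ≤ b + 2 * η by linarith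
    have := hN C
    have key := finrank_add_finrank_map_le (I.inv C D hCD).hom
      (I.imageSub_mono (b := B) (c := C) h h' le_rfl)
    rw [I.map_inv_imageSub h' hBD, I.map_inv_imageSub (h.trans h') hBD, finrank_imageSub,
      finrank_imageSub] at key
    rw [I.rank_eq hη hb, I.rank_eq hη hb]
    linarith
  · rw [I.rank_of_lt hη (by linarith), persistentRank_of_lt (by linarith)]
    exact Nat.zero_le _

/-- This and the next lemma supply the hypotheses of `exists_matching_of_submodule`: the image lies
between two images of `N`, and nested subspaces are pushed along a structure map of `N`. -/
theorem Interleaving.rank_add_persistentRank_shift_le (hN : PointwiseFinite N) {a b b' : ℝ}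
    (h : a ≤ b) (h' : b ≤ b') :
    I.rank hη a b + persistentRank N (a + η) (b' + η) ≤
      I.rank hη a b' + persistentRank N (a + η) (b + η) := by
  by_cases ha : r ≤ a
  · have hb : r ≤ b := ha.trans h
    let B : Set.Ici r := ⟨b, hb⟩
    let C : Set.Ici r := ⟨b + η, show r ≤ b + η by linarith⟩
    let C' : Set.Ici r := ⟨b' + η, show r ≤ b' + η by linarith⟩
    let f : C ⟶ C' := homOfLE (add_le_add_left h' η)
    have := hN C
    have key := finrank_add_finrank_map_le (N.map f).hom
      (I.imageSub_le (b := B) (c := C) h le_rfl hη (add_le_add_left h η) le_rfl)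
    rw [I.map_imageSub (b' := ⟨b', hb.trans h'⟩) h h' f le_rfl le_rfl,
      MultiMapper.map_imageSub (add_le_add_left h η) f, finrank_imageSub, finrank_imageSub] at key
    rw [I.rank_eq hη hb, I.rank_eq hη (hb.trans h')]
    linarith
  -- The image vanishes, but `a + η` may exceed `r`, so the terms of `N` still have to be compared.
  · rw [I.rank_of_lt hη (by linarith), I.rank_of_lt hη (by linarith), zero_add, zero_add]
    exact (isRankFunction_persistentRank hN).anti (by linarith) (by linarith)

theorem Interleaving.persistentRank_shift_add_rank_le (hN : PointwiseFinite N) {a b b' : ℝ}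
    (h : a ≤ b) (h' : b ≤ b') :
    persistentRank N (a - η) (b + η) + I.rank hη a b' ≤
      persistentRank N (a - η) (b' + η) + I.rank hη a b := by
  by_cases ha : r ≤ a
  · have hb : r ≤ b := ha.trans h
    let B : Set.Ici r := ⟨b, hb⟩
    let C : Set.Ici r := ⟨b + η, show r ≤ b + η by linarith⟩
    let C' : Set.Ici r := ⟨b' + η, show r ≤ b' + η by linarith⟩
    let f : C ⟶ C' := homOfLE (add_le_add_left h' η)
    have := hN C
    have key := finrank_add_finrank_map_le (N.map f).hom
      (I.le_imageSub (a := a - η) (b := B) (c := C) h (by linarith) hη le_rfl)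
    rw [I.map_imageSub (b' := ⟨b', hb.trans h'⟩) h h' f le_rfl le_rfl,
      MultiMapper.map_imageSub (show a - η ≤ b + η by linarith) f, finrank_imageSub,
      finrank_imageSub] at key
    rw [I.rank_eq hη hb, I.rank_eq hη (hb.trans h')]
    linarith
  · rw [I.rank_of_lt hη (by linarith), I.rank_of_lt hη (by linarith),
      persistentRank_of_lt (by linarith)]
    exact Nat.zero_le _

include I hη in
-- A point `(b, d)` of the image goes to birth `b` and death in `[d, d + 2η]` on the side of `M`,
-- and to birth in `[b - η, b + η]` and death `d + η` on the side of `N`. Both coordinates differ by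
-- at most `η`.
theorem Interleaving.exists_finite_matching (hM : PointwiseFinite M) (hN : PointwiseFinite N) :
    ∃ (e : Points (rankMult (I.rank hη)) → Points (rankMult (persistentRank M)))
      (e' : Points (rankMult (I.rank hη)) → Points (rankMult (persistentRank N))),
      Function.Injective e ∧ Function.Injective e' ∧
      (∀ p, |(e p).1.1 - (e' p).1.1| ≤ η ∧ |(e p).1.2 - (e' p).1.2| ≤ η) ∧
      (∀ q, q ∉ Set.range e → q.1.2 - q.1.1 ≤ 2 * η) ∧
      ∀ q, q ∉ Set.range e' → q.1.2 - q.1.1 ≤ 2 * η := by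
  have hI := I.isRankFunction hη hN
  obtain ⟨e, h1, h2, h3⟩ := exists_matching_of_quotient (κ := 2 * η) hI
    (isRankFunction_persistentRank hM) (I.rank_add_persistentRank_le hη hM)
    (I.persistentRank_add_rank_le hη hN) (by linarith)
  obtain ⟨e', h1', h2', h3'⟩ := exists_matching_of_submodule hI
    (isRankFunction_persistentRank hN) (I.rank_add_persistentRank_shift_le hη hN)
    (I.persistentRank_shift_add_rank_le hη hN) hη
  refine ⟨e, e', h1, h1', fun p => ?_, h3, h3'⟩
  obtain ⟨a1, a2, a3⟩ := h2 p
  obtain ⟨b1, b2, b3⟩ := h2' p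
  rw [a1, b1, abs_le, abs_le]
  exact ⟨⟨by linarith, by linarith⟩, by linarith, by linarith⟩

include I hη in
-- The structure map of `M` from `a` to `b + 2 * η` factors through that of `N` from `a + η` to `b +
-- η`.
theorem Interleaving.persistentRank_le (hN : PointwiseFinite N) {a b : ℝ}
    (h : a ≤ b) : persistentRank M a (b + 2 * η) ≤ persistentRank N (a + η) (b + η) := by
  by_cases ha : r ≤ a
  · have hb : r ≤ b := ha.trans h
    have hN' := hN ⟨b + η, show r ≤ b + η by linarith⟩
    rw [← finrank_imageSub _ ⟨b + 2 * η, show r ≤ b + 2 * η by linarith⟩,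
      ← finrank_imageSub _ ⟨b + η, show r ≤ b + η by linarith⟩,
      ← I.map_inv_imageSub (b := ⟨b, hb⟩) (c := ⟨b + η, show r ≤ b + η by linarith⟩) h
        (show b ≤ b + 2 * η by linarith) le_rfl (show b + η + η ≤ b + 2 * η by linarith)]
    exact (Submodule.finrank_map_le _ _).trans
      (Submodule.finrank_mono (I.imageSub_le h le_rfl hη (add_le_add_left h η) _))
  · rw [persistentRank_of_lt (not_le.1 ha)]
    exact Nat.zero_le _

include I hη in
/-- Stability: the diagrams of `η`-interleaved persistence modules have bottleneck distance at
most `η`. -/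
theorem Interleaving.bottleneckDist_le (hM : PointwiseFinite M) (hN : PointwiseFinite N) :
    bottleneckDist (diagram M) (diagram N) ≤ ENNReal.ofReal η := by
  obtain ⟨e, e', he, he', h1, h2, h3⟩ := I.exists_finite_matching hη hM hN
  obtain ⟨μ, m1, m2, m3⟩ := exists_pequiv_of_injective he he'
  obtain ⟨ε, hε⟩ := exists_essential_matching (κ := η) (isRankFunction_persistentRank hM)
    (isRankFunction_persistentRank hN) (fun h => I.persistentRank_le hη hN h)
    (fun h => I.symm.persistentRank_le hη hM h) hη
  have hd : ∀ p : ℝ × ℝ, p.2 - p.1 ≤ 2 * η → diagDist p ≤ ENNReal.ofReal η := fun p hp =>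
    ENNReal.ofReal_le_ofReal (by linarith)
  have hdist : ∀ x y : ℝ, |x - y| ≤ η → edist x y ≤ ENNReal.ofReal η := fun x y h => by
    rw [edist_dist, Real.dist_eq]
    exact ENNReal.ofReal_le_ofReal h
  -- By definition, `diagram` consists of `rankMult` and `rankEss` of the persistent rank.
  refine (iInf₂_le μ ε).trans (max_le (max_le ?_ (max_le ?_ ?_)) ?_)
  · refine iSup_le fun x => iSup_le fun y => iSup_le fun hxy => ?_
    obtain ⟨p, rfl, rfl⟩ := m1 x y hxy
    exact max_le (hdist _ _ (h1 p).1) (hdist _ _ (h1 p).2)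
  · exact iSup_le fun x => iSup_le fun hx => hd _ (h2 x (m2 x hx))
  · exact iSup_le fun y => iSup_le fun hy => hd _ (h3 y (m3 y hy))
  · exact iSup_le fun x => hdist _ _ (hε x)

end Interleaving

/-! ### Interleaving of multiscale mappers -/

/-- A continuous map carries each path component of `A` into a path component of `B`. -/
theorem exists_component_of_mapsTo {X Y : Type u} [TopologicalSpace X] [TopologicalSpace Y]
    {A : Set Y} {B : Set X} {h : Y → X} (hc : Continuous h) (hAB : Set.MapsTo h A B)
    (c : ZerothHomotopy A) :
    ∃ c' : ZerothHomotopy B, ∀ y ∈ componentSet c, h y ∈ componentSet c' := by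
  have hr : Continuous (hAB.restrict h A B) := hc.restrict hAB
  have hj : ∀ x y : A, Joined x y → Joined (hAB.restrict h A B x) (hAB.restrict h A B y) :=
    fun _ _ ⟨p⟩ => ⟨p.map hr⟩
  refine ⟨Quotient.map _ hj c, ?_⟩
  rintro y ⟨hy, rfl⟩
  exact ⟨hAB hy, rfl⟩

/-- No compatibility between the chosen members at different scales is required: each identity
compares two maps of covers over the same map of spaces. -/
theorem nonempty_interleaving_mapperHomology (F : Type u) [Field F] (k : ℕ) {X Y : Type u}
    {Z : Type v} [TopologicalSpace X] [TopologicalSpace Y] (W : CoverTower.{u} Z)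
    (hW : 0 < W.res) (f : Y → Z) (g : X → Z) (h : X ≃ₜ Y) (η : ℝ)
    (hfg : ∀ a b : Set.Ici (Real.log W.res), (a : ℝ) + η ≤ b → ∀ i : (W.reindexLog hW).ι a,
      ∃ j : (W.reindexLog hW).ι b, ∀ y, f y ∈ (W.reindexLog hW).U a i →
        g (h.symm y) ∈ (W.reindexLog hW).U b j)
    (hgf : ∀ a b : Set.Ici (Real.log W.res), (a : ℝ) + η ≤ b → ∀ i : (W.reindexLog hW).ι a,
      ∃ j : (W.reindexLog hW).ι b, ∀ x, g x ∈ (W.reindexLog hW).U a i →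
        f (h x) ∈ (W.reindexLog hW).U b j) :
    Nonempty (Interleaving (mapperHomology F k W hW f) (mapperHomology F k W hW g) η) := by
  let T := W.reindexLog hW
  let V := T.pullback f
  let V' := T.pullback g
  have e₁ : ∀ (a b : Set.Ici (Real.log W.res)), (a : ℝ) + η ≤ b → ∀ i : V.ι a, ∃ j : V'.ι b,
      ∀ y ∈ V.U a i, h.symm y ∈ V'.U b j := by
    rintro a b hab ⟨i, c⟩
    obtain ⟨j, hj⟩ := hfg a b hab i
    obtain ⟨c', hc'⟩ := exists_component_of_mapsTo (A := f ⁻¹' T.U a i) (B := g ⁻¹' T.U b j)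
      h.symm.continuous hj c
    exact ⟨⟨j, c'⟩, hc'⟩
  have e₂ : ∀ (a b : Set.Ici (Real.log W.res)), (a : ℝ) + η ≤ b → ∀ i : V'.ι a, ∃ j : V.ι b,
      ∀ x ∈ V'.U a i, h x ∈ V.U b j := by
    rintro a b hab ⟨i, c⟩
    obtain ⟨j, hj⟩ := hgf a b hab i
    obtain ⟨c', hc'⟩ := exists_component_of_mapsTo (A := g ⁻¹' T.U a i) (B := f ⁻¹' T.U b j)
      h.continuous hj c
    exact ⟨⟨j, c'⟩, hc'⟩
  choose φ hφ using e₁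
  choose ψ hψ using e₂
  refine ⟨{
    hom := fun a b hab => nerveHomologyMap F k h.symm (φ a b hab) (hφ a b hab)
    inv := fun a b hab => nerveHomologyMap F k h (ψ a b hab) (hψ a b hab)
    map_hom := fun {a a' b} p hab hab' => ?_
    hom_map := fun {a b b'} p hab hab' => ?_
    map_inv := fun {a a' b} p hab hab' => ?_
    inv_map := fun {a b b'} p hab hab' => ?_
    hom_inv := fun {a b c} hab hbc p => ?_
    inv_hom := fun {a b c} hab hbc p => ?_ }⟩
  · rw [mapperHomology_map]
    exact (nerveHomologyMap_comp F k _ _ _ _ _ _).trans (nerveHomologyMap_congr F k rfl _ _ _ _)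
  · rw [mapperHomology_map]
    exact (nerveHomologyMap_comp F k _ _ _ _ _ _).trans (nerveHomologyMap_congr F k rfl _ _ _ _)
  · rw [mapperHomology_map]
    exact (nerveHomologyMap_comp F k _ _ _ _ _ _).trans (nerveHomologyMap_congr F k rfl _ _ _ _)
  · rw [mapperHomology_map]
    exact (nerveHomologyMap_comp F k _ _ _ _ _ _).trans (nerveHomologyMap_congr F k rfl _ _ _ _)
  · rw [mapperHomology_map]
    exact (nerveHomologyMap_comp F k _ _ _ _ _ _).trans
      (nerveHomologyMap_congr F k (funext h.apply_symm_apply) _ _ _ _)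
  · rw [mapperHomology_map]
    exact (nerveHomologyMap_comp F k _ _ _ _ _ _).trans
      (nerveHomologyMap_congr F k (funext h.symm_apply_apply) _ _ _ _)

/-- In a good tower, the `δ`-neighbourhood of a member of the cover at scale `a` is contained in a
member of the cover at every scale at least `c * (a + 2 δ)`, if `s ≤ δ`. -/
theorem CoverTower.IsGood.exists_superset_thickening {Z : Set ℝ} (hZ : Z.OrdConnected)
    {W : CoverTower.{u} Z} {c s δ : ℝ} (hgood : W.IsGood c s) (hδ : s ≤ δ) {a b : Set.Ici W.res}
    (hab : c * (a + 2 * δ) ≤ b) (i : W.ι a) (hne : (W.U a i).Nonempty) :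
    ∃ j : W.ι b, ∀ z ∈ W.U a i, ∀ z' : Z, |(z : ℝ) - z'| ≤ δ → z' ∈ W.U b j := by
  have hs := hgood.pos
  have hc := hgood.one_le
  have ha : s ≤ a := hgood.res_eq ▸ a.2
  let O : Set Z := {z' | ∃ z ∈ W.U a i, |(z : ℝ) - z'| ≤ δ}
  have hdist : ∀ x ∈ O, ∀ y ∈ O, dist x y ≤ a + 2 * δ := by
    rintro x ⟨z, hz, hzx⟩ y ⟨w, hw, hwy⟩
    have h1 : edist z w ≤ ENNReal.ofReal a :=
      (Metric.edist_le_ediam_of_mem hz hw).trans (hgood.diam_le a i)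
    rw [edist_dist, ENNReal.ofReal_le_ofReal_iff (by linarith), Subtype.dist_eq,
      Real.dist_eq] at h1
    rw [Subtype.dist_eq, Real.dist_eq]
    rw [abs_le] at *
    constructor <;> linarith
  have hbdd : Bornology.IsBounded O := Metric.isBounded_iff.2 ⟨_, fun x hx y hy => hdist x hx y hy⟩
  have hdiam : Metric.diam O ≤ a + 2 * δ := Metric.diam_le_of_forall_dist_le (by linarith) hdist
  -- Either `O` is all of `Z`, whose diameter is at least `s`, or the interval `Z` reaches further
  -- than `δ ≥ s` from `z` on one side, and then `z - s` or `z + s` lies in `O`.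
  have hsO : s ≤ Metric.diam O := by
    obtain ⟨z, hz⟩ := hne
    have hzO : z ∈ O := ⟨z, hz, by rw [sub_self, abs_zero]; linarith⟩
    by_cases hall : ∀ z' : Z, |(z : ℝ) - z'| ≤ δ
    · have hO : O = Set.univ := Set.eq_univ_of_forall fun z' => ⟨z, hz, hall z'⟩
      have := hgood.le_diam
      rw [← hO, ENNReal.ofReal_le_iff_le_toReal hbdd.ediam_ne_top] at this
      exact this
    · push Not at hall
      obtain ⟨z', hz'⟩ := hall
      rcases lt_abs.1 hz' with h | h
      · have hw : (z : ℝ) - s ∈ Z := hZ.out z'.2 z.2 ⟨by linarith, by linarith⟩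
        have hwO : (⟨_, hw⟩ : Z) ∈ O := ⟨z, hz, by
          rw [sub_sub_cancel, abs_of_pos hs]; exact hδ⟩
        have := Metric.dist_le_diam_of_mem hbdd hzO hwO
        rwa [Subtype.dist_eq, Real.dist_eq, sub_sub_cancel, abs_of_pos hs] at this
      · have hw : (z : ℝ) + s ∈ Z := hZ.out z.2 z'.2 ⟨by linarith, by linarith⟩
        have hwO : (⟨_, hw⟩ : Z) ∈ O := ⟨z, hz, by
          rw [sub_add_cancel_left, abs_neg, abs_of_pos hs]; exact hδ⟩
        have := Metric.dist_le_diam_of_mem hbdd hzO hwO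
        rwa [Subtype.dist_eq, Real.dist_eq, sub_add_cancel_left, abs_neg, abs_of_pos hs] at this
  have hres : W.res ≤ c * Metric.diam O := by
    rw [hgood.res_eq]
    nlinarith
  obtain ⟨j, hj⟩ := hgood.exists_superset O hbdd hsO ⟨_, hres⟩ rfl
  have hle : (⟨_, hres⟩ : Set.Ici W.res) ≤ b :=
    show c * Metric.diam O ≤ b from (mul_le_mul_of_nonneg_left hdiam (by linarith)).trans hab
  exact ⟨W.map hle j, fun z hz z' hz' => W.subset_map hle j (hj ⟨z, hz, hz'⟩)⟩

/-- Logarithmic rescaling turns the multiplicative shift of the scales into an additive one. -/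
theorem mul_exp_add_le_exp {c s δ a b : ℝ} (hc : 1 ≤ c) (hδ : 0 ≤ δ)
    (ha : Real.log s ≤ a) (hab : a + (Real.log (2 * c * δ + c) + max 0 (Real.log (1 / s))) ≤ b) :
    c * (Real.exp a + 2 * δ) ≤ Real.exp b := by
  have hcδ : 0 ≤ c * δ := mul_nonneg (by linarith) hδ
  have hpos : 0 < 2 * c * δ + c := by linarith
  -- This exponential is `exp a * max 1 (1 / s)`. It dominates both `1` and `exp a`, which bounds
  -- `2cδ` and `c * exp a` separately.
  have h1 : 1 ≤ Real.exp (a + max 0 (Real.log (1 / s))) := by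
    refine Real.one_le_exp ?_
    have := le_max_right 0 (Real.log (1 / s))
    rw [one_div, Real.log_inv] at this ⊢
    linarith
  have h2 : Real.exp a ≤ Real.exp (a + max 0 (Real.log (1 / s))) :=
    Real.exp_le_exp.2 (le_add_of_nonneg_right (le_max_left _ _))
  have h3 : Real.exp (a + max 0 (Real.log (1 / s))) * (2 * c * δ + c) ≤ Real.exp b := by
    nth_rewrite 1 [← Real.exp_log hpos]
    rw [← Real.exp_add]
    exact Real.exp_le_exp.2 (by linarith)
  refine le_trans ?_ h3
  nlinarith [mul_le_mul_of_nonneg_left h1 hcδ, mul_le_mul_of_nonneg_left h2 (zero_le_one.trans hc)]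

/-! ### Finiteness -/

/-- Only members meeting `T` have a nonempty preimage, and empty preimages contribute no components;
hence the nerve has finitely many vertices. -/
theorem pointwiseFinite_mapperHomology (F : Type u) [Field F] (k : ℕ) {X : Type u} {Z : Type v}
    [TopologicalSpace X] [TopologicalSpace Z] (W : CoverTower.{u} Z) (hW : 0 < W.res)
    (hopen : W.IsOpenTower) {f : X → Z} (hf : WellBehaved f) {T : Set Z} (hT : IsCompact T)
    (hfT : ∀ x, f x ∈ T) : PointwiseFinite (mapperHomology F k W hW f) := by
  intro a
  let b := expIci hW a
  have : Finite (Σ i : W.ι b, ZerothHomotopy (f ⁻¹' W.U b i)) := by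
    have hfin := (hopen.locallyFinite b).finite_nonempty_inter_compact hT
    have : Finite {i | (W.U b i ∩ T).Nonempty} := hfin
    have (i : {i | (W.U b i ∩ T).Nonempty}) : Finite (ZerothHomotopy (f ⁻¹' W.U b i)) :=
      hf _ (hopen.isOpen b i) (hopen.isPathConnected b i)
    refine Finite.of_surjective (fun p : Σ i : {i | (W.U b i ∩ T).Nonempty},
      ZerothHomotopy (f ⁻¹' W.U b i) => (⟨p.1, p.2⟩ : Σ i : W.ι b, ZerothHomotopy (f ⁻¹' W.U b i))) ?_
    rintro ⟨i, c⟩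
    induction c using Quotient.inductionOn with
    | h x => exact ⟨⟨⟨i, f x, x.2, hfT x⟩, Quotient.mk _ x⟩, rfl⟩
  exact finite_nerveHomology F k (ι := Σ i : W.ι b, ZerothHomotopy (f ⁻¹' W.U b i)) _

/-! ### Piecewise linear functions: compact range and finitely many components -/

section PL

variable {E : Type u} [NormedAddCommGroup E] [NormedSpace ℝ E]
  {K : Geometry.SimplicialComplex ℝ E}

theorem isCompact_space (hK : K.faces.Finite) : IsCompact K.space :=
  hK.isCompact_biUnion fun σ _ => σ.finite_toSet.isCompact_convexHull ℝ

theorem IsPL.apply_segment {f : K.space → ℝ} (hf : IsPL K f) {σ : Finset E} (hσ : σ ∈ K.faces)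
    {y y' z : K.space} (hy : (y : E) ∈ convexHull ℝ (σ : Set E))
    (hy' : (y' : E) ∈ convexHull ℝ (σ : Set E)) {s t : ℝ} (hs : 0 ≤ s) (ht : 0 ≤ t)
    (hst : s + t = 1) (hz : (z : E) = s • (y : E) + t • (y' : E)) : f z = s * f y + t * f y' := by
  obtain ⟨φ, hφ⟩ := hf
  obtain ⟨w, hw, hw1, hwy⟩ := Finset.mem_convexHull'.1 hy
  obtain ⟨w', hw', hw1', hwy'⟩ := Finset.mem_convexHull'.1 hy'
  rw [hφ σ hσ w hw hw1 y hwy.symm, hφ σ hσ w' hw' hw1' y' hwy'.symm,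
    hφ σ hσ (fun v => s * w v + t * w' v)
      (fun v hv => add_nonneg (mul_nonneg hs (hw v hv)) (mul_nonneg ht (hw' v hv)))
      (by rw [Finset.sum_add_distrib, ← Finset.mul_sum, ← Finset.mul_sum, hw1, hw1', mul_one,
        mul_one, hst]) z
      (by simp only [add_smul, mul_smul]
          rw [Finset.sum_add_distrib, ← Finset.smul_sum, ← Finset.smul_sum, hwy, hwy', hz]),
    Finset.mul_sum, Finset.mul_sum, ← Finset.sum_add_distrib]
  exact Finset.sum_congr rfl fun v _ => by ring

/-- `T` is the union, over the simplices, of the convex hulls of the vertex values; it lies in `Z`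
because vertices are points of `|K|`. Continuity of `f` is not needed. -/
theorem IsPL.exists_isCompact {f : K.space → ℝ} (hf : IsPL K f) (hK : K.faces.Finite) {Z : Set ℝ}
    (hZ : Z.OrdConnected) (hfZ : ∀ y, f y ∈ Z) :
    ∃ T : Set Z, IsCompact T ∧ ∀ y, Set.codRestrict f Z hfZ y ∈ T := by
  obtain ⟨φ, hφ⟩ := hf
  have hφZ : ∀ σ ∈ K.faces, convexHull ℝ (φ '' σ) ⊆ Z := by
    intro σ hσ
    refine convexHull_min ?_ hZ.convex
    rintro _ ⟨v, hv, rfl⟩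
    have hv' : {v} ∈ K.faces := K.down_closed hσ (by simpa using hv) (Finset.singleton_nonempty v)
    have hvK : v ∈ K.space := Geometry.SimplicialComplex.mem_space_iff.2 ⟨{v}, hv', by simp⟩
    have := hφ {v} hv' (fun _ => 1) (by simp) (by simp) ⟨v, hvK⟩ (by simp)
    simp only [Finset.sum_singleton, one_mul] at this
    exact this ▸ hfZ _
  refine ⟨⋃ σ ∈ K.faces, Subtype.val ⁻¹' convexHull ℝ (φ '' σ), hK.isCompact_biUnion fun σ hσ => ?_,
    fun y => ?_⟩
  · rw [Topology.IsInducing.subtypeVal.isCompact_preimage_iff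
      (by rw [Subtype.range_val]; exact hφZ σ hσ)]
    exact (σ.finite_toSet.image φ).isCompact_convexHull ℝ
  · obtain ⟨σ, hσ, hy⟩ := Geometry.SimplicialComplex.mem_space_iff.1 y.2
    obtain ⟨w, hw, hw1, hwy⟩ := Finset.mem_convexHull'.1 hy
    refine Set.mem_biUnion hσ ?_
    rw [Set.mem_preimage, Set.val_codRestrict_apply, hφ σ hσ w hw hw1 y hwy.symm]
    exact (convex_convexHull ℝ _).sum_mem hw hw1
      fun v hv => subset_convexHull ℝ _ ⟨v, hv, rfl⟩

/-- A path connected `V` is an interval, and `f` is affine on each simplex, so two points of the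
preimage in one simplex are joined by a segment. There are at most as many components as simplices.
-/
theorem IsPL.wellBehaved {f : K.space → ℝ} (hf : IsPL K f) (hK : K.faces.Finite) {Z : Set ℝ}
    (hfZ : ∀ y, f y ∈ Z) : WellBehaved (Set.codRestrict f Z hfZ) := by
  intro V _ hV
  have hconv : Convex ℝ (Subtype.val '' V : Set ℝ) :=
    (hV.image continuous_subtype_val).isConnected.isPreconnected.ordConnected.convex
  let A := Set.codRestrict f Z hfZ ⁻¹' V
  have hA : ∀ y : K.space, y ∈ A ↔ f y ∈ (Subtype.val '' V : Set ℝ) := fun y =>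
    ⟨fun h => ⟨_, h, rfl⟩, fun ⟨z, hz, hzy⟩ => by
      have : Set.codRestrict f Z hfZ y = z := Subtype.ext hzy.symm
      rwa [Set.mem_preimage, this]⟩
  have key : ∀ σ ∈ K.faces, {c : ZerothHomotopy A | ∃ y : A,
      ((y : K.space) : E) ∈ convexHull ℝ (σ : Set E) ∧ Quotient.mk _ y = c}.Finite := by
    intro σ hσ
    refine Set.Subsingleton.finite ?_
    rintro _ ⟨y, hy, rfl⟩ _ ⟨y', hy', rfl⟩
    refine Quotient.sound ?_
    have hmem : ∀ t : unitInterval, (1 - (t : ℝ)) • ((y : K.space) : E) + (t : ℝ) •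
        ((y' : K.space) : E) ∈ convexHull ℝ (σ : Set E) := fun t =>
      convex_convexHull ℝ _ hy hy' (by linarith [t.2.2]) t.2.1 (by ring)
    have hmemK : ∀ t : unitInterval, (1 - (t : ℝ)) • ((y : K.space) : E) + (t : ℝ) •
        ((y' : K.space) : E) ∈ K.space := fun t =>
      Geometry.SimplicialComplex.mem_space_iff.2 ⟨σ, hσ, hmem t⟩
    have hmemA : ∀ t : unitInterval, (⟨_, hmemK t⟩ : K.space) ∈ A := fun t => by
      rw [hA, hf.apply_segment hσ (z := ⟨_, hmemK t⟩) hy hy' (by linarith [t.2.2]) t.2.1 (by ring) rfl]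
      exact hconv ((hA y).1 y.2) ((hA y').1 y'.2) (by linarith [t.2.2]) t.2.1 (by ring)
    exact ⟨{ toFun := fun t => ⟨⟨_, hmemK t⟩, hmemA t⟩
             continuous_toFun := by fun_prop
             source' := by ext; simp
             target' := by ext; simp }⟩
  refine Set.finite_univ_iff.1 ((hK.biUnion key).subset fun c _ => ?_)
  induction c using Quotient.inductionOn with
  | h y =>
    obtain ⟨σ, hσ, hy⟩ := Geometry.SimplicialComplex.mem_space_iff.1 y.1.2
    exact Set.mem_biUnion hσ ⟨y, hy, rfl⟩

end PL

end MultiMapper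

end

/-! ### The stability theorem -/

theorem mainTheorem10
    (F : Type u) [Field F]
    {E : Type u} [NormedAddCommGroup E] [NormedSpace ℝ E]
    (K : Geometry.SimplicialComplex ℝ E) (hK : K.faces.Finite)
    {X : Type u} [TopologicalSpace X]
    (Z : Set ℝ) (hZ : Z.OrdConnected)
    (W : MultiMapper.CoverTower.{u} Z) (c s δ : ℝ)
    (hW : W.IsOpenTower) (hgood : W.IsGood c s)
    (f : K.space → ℝ) (hfZ : ∀ y, f y ∈ Z) (hf : MultiMapper.IsPL K f)
    (g : X → ℝ) (hgZ : ∀ x, g x ∈ Z) (hg : Continuous g)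
    (hgw : MultiMapper.WellBehaved (Set.codRestrict g Z hgZ))
    (happrox : MultiMapper.DeltaApproximates K f g δ) (k : ℕ) :
    MultiMapper.PointwiseFinite
        (MultiMapper.mapperHomology F k W hgood.res_pos (Set.codRestrict f Z hfZ)) ∧
      MultiMapper.PointwiseFinite
        (MultiMapper.mapperHomology F k W hgood.res_pos (Set.codRestrict g Z hgZ)) ∧
      MultiMapper.bottleneckDist
          (MultiMapper.diagram
            (MultiMapper.mapperHomology F k W hgood.res_pos (Set.codRestrict f Z hfZ)))
          (MultiMapper.diagram
            (MultiMapper.mapperHomology F k W hgood.res_pos (Set.codRestrict g Z hgZ))) ≤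
        ENNReal.ofReal (Real.log (2 * c * max s δ + c) + max 0 (Real.log (1 / s))) := by
  have hc := hgood.one_le
  have hs := hgood.pos
  have hs' : s ≤ max s δ := le_max_left _ _
  obtain ⟨T, hT, hfT⟩ := hf.exists_isCompact hK hZ hfZ
  obtain ⟨h, hh⟩ := happrox
  have : CompactSpace K.space := isCompact_iff_compactSpace.1 (MultiMapper.isCompact_space hK)
  have : CompactSpace X := h.symm.compactSpace
  have hM := MultiMapper.pointwiseFinite_mapperHomology F k W hgood.res_pos hW
    (hf.wellBehaved hK hfZ) hT hfT
  have hN := MultiMapper.pointwiseFinite_mapperHomology F k W hgood.res_pos hW hgw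
    (isCompact_range (hg.codRestrict hgZ)) Set.mem_range_self
  have hcδ : 0 ≤ c * max s δ := mul_nonneg (by linarith) (by linarith)
  have hη : 0 ≤ Real.log (2 * c * max s δ + c) + max 0 (Real.log (1 / s)) :=
    add_nonneg (Real.log_nonneg (by linarith)) (le_max_left _ _)
  -- Neighbourhoods of radius `max s δ` are used instead of `δ`, so that their diameter is at least
  -- `s` and goodness applies.
  have hscale : ∀ a b : Set.Ici (Real.log W.res),
      (a : ℝ) + (Real.log (2 * c * max s δ + c) + max 0 (Real.log (1 / s))) ≤ b →
      ∀ i : (W.reindexLog hgood.res_pos).ι a, ∃ j : (W.reindexLog hgood.res_pos).ι b,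
        ∀ z ∈ (W.reindexLog hgood.res_pos).U a i, ∀ z' : Z, |(z : ℝ) - z'| ≤ max s δ →
          z' ∈ (W.reindexLog hgood.res_pos).U b j := fun a b hab i =>
    hgood.exists_superset_thickening hZ hs'
      (a := MultiMapper.expIci hgood.res_pos a) (b := MultiMapper.expIci hgood.res_pos b)
      (MultiMapper.mul_exp_add_le_exp hc (hs.le.trans hs')
        ((congrArg Real.log hgood.res_eq).symm.le.trans a.2) hab) i
      (hW.isPathConnected _ i).nonempty
  obtain ⟨I⟩ := MultiMapper.nonempty_interleaving_mapperHomology F k W hgood.res_pos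
    (Set.codRestrict f Z hfZ) (Set.codRestrict g Z hgZ) h _
    (fun a b hab i => by
      obtain ⟨j, hj⟩ := hscale a b hab i
      exact ⟨j, fun y hy => hj _ hy _ ((hh y).trans (le_max_right _ _))⟩)
    (fun a b hab i => by
      obtain ⟨j, hj⟩ := hscale a b hab i
      refine ⟨j, fun x hx => hj _ hx _ ?_⟩
      have := hh (h x)
      rw [h.symm_apply_apply, abs_sub_comm] at this
      exact this.trans (le_max_right _ _))
  exact ⟨hM, hN, I.bottleneckDist_le hη hM hN⟩
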